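/- All simplicial complexes are finite, contain the empty face, and $[m]=\{1,\dots,m\}$. For a simplicial complex $\Delta$, let $\mathrm{sd}_{\mathcal A}(\Delta)$ be its antiprism triangulation: the clique complex of the graph whose nodes are the pointed faces $(F,v)$ of $\Delta$ (that is, $v\in F\in\Delta$), where two distinct nodes $(F,v)$, $(F',v')$ are adjacent if $F=F'$, or $F\subsetneq F'$ and $v'\in F'\smallsetminus F$, or $F'\subsetneq F$ and $v\in F\smallsetminus F'$. For $\Delta$ of dimension $n-1$, let $f_{j-1}(\Delta)$ be its number of faces with $j$ elements and $h_i(\Delta)=\sum_{j=0}^{i}(-1)^{i-j}\binom{n-j}{i-j}f_{j-1}(\Delta)$ for $0\le i\le n$. An ordered set partition of a set $S$ is a sequence of nonempty, pairwise disjoint sets (blocks) with union $S$. Let $n\ge 1$. There are integers $p_{\mathcal A}(n,k,j)$, for $0\le k,j\le n$, such that $$h_j(\mathrm{sd}_{\mathcal A}(\Delta))=\sum_{k=0}^{n}p_{\mathcal A}(n,k,j)\,h_k(\Delta)$$ for every $(n-1)$-dimensional simplicial complex $\Delta$ and every $j\in\{0,1,\dots,n\}$. They are uniquely determined by this property, and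 for all $k,j\in\{0,1,\dots,n\}$ the number $p_{\mathcal A}(n,k,j)$ is equal to each of the following: (i) the number of ways to choose a set $[k]\subseteq S\subseteq[n]$ and an ordered set partition $\pi$ of $S$, and to color $j$ elements of $S$ black and the remaining elements of $S$ white, so that every monochromatic block $B$ of $\pi$ (if any) is the first block of $\pi$, is contained in $[k]$, and has all its elements colored black; (ii) the number of ordered set partitions $(B_1,B_2,\dots,B_m)$ of $[n]$ such that $\bigcup_{i=1}^{\lfloor m/2\rfloor}B_i$ has exactly $j$ elements if $m$ is even, and the union of $\bigcup_{i=1}^{\lfloor m/2\rfloor}B_i$ and $B_m\cap[k]$ has exactly $j$ elements if $m$ is odd. -/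

import Mathlib

universe u

namespace Antiprism

/-! ### Simplicial complexes, `f`-vectors and `h`-vectors

Mathlib's `AbstractSimplicialComplex V` lists the nonempty faces of a complex with vertex set `V`;
the empty face is always understood to be a face as well. -/

section Complexes

variable {V : Type u}

/-- `dim Δ + 1`: the largest cardinality of a face (which is `0` if there is only the empty
face). -/
noncomputable def size (Δ : AbstractSimplicialComplex V) : ℕ :=
  sSup (Finset.card '' Δ.faces)

/-- `fNumber Δ j` is the number `f_{j-1}(Δ)` of faces with `j` elements, the empty face
included. -/
noncomputable def fNumber (Δ : AbstractSimplicialComplex V) (j : ℕ) : ℕ :=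
  {F : Finset V | (F = ∅ ∨ F ∈ Δ.faces) ∧ F.card = j}.ncard

/-- The entry `h_i(Δ)`, for `0 ≤ i ≤ dim Δ + 1`, of the `h`-vector of `Δ`. -/
noncomputable def hNumber (Δ : AbstractSimplicialComplex V) (i : ℕ) : ℤ :=
  ∑ j ∈ Finset.range (i + 1),
    (-1) ^ (i - j) * ((size Δ - j).choose (i - j) : ℤ) * (fNumber Δ j : ℤ)

/-- The clique complex of a graph. -/
def cliqueComplex {W : Type u} (G : SimpleGraph W) : AbstractSimplicialComplex W where
  faces := {s | s.Nonempty ∧ G.IsClique (s : Set W)}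
  isRelLowerSet_faces := fun _ hs =>
    ⟨hs.1, fun _ hts ht => ⟨ht, hs.2.subset (Finset.coe_subset.mpr hts)⟩⟩
  singleton_mem := fun v => ⟨Finset.singleton_nonempty v, by simp⟩

/-- Pointed faces of `Δ`: pairs `(F, v)` of a face `F` and a vertex `v ∈ F`. -/
abbrev PointedFace (Δ : AbstractSimplicialComplex V) : Type u :=
  {p : Finset V × V // p.1 ∈ Δ.faces ∧ p.2 ∈ p.1}

/-- The graph on the pointed faces of `Δ` in which two distinct pointed faces `(F, v)` and
`(F', v')` are adjacent if `F = F'`, or `F ⊊ F'` and `v' ∈ F' \ F`, or `F' ⊊ F` and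
`v ∈ F \ F'`. -/
def pointedFaceGraph (Δ : AbstractSimplicialComplex V) : SimpleGraph (PointedFace Δ) where
  Adj a b := a ≠ b ∧
    (a.1.1 = b.1.1 ∨ (a.1.1 ⊂ b.1.1 ∧ b.1.2 ∉ a.1.1) ∨ (b.1.1 ⊂ a.1.1 ∧ a.1.2 ∉ b.1.1))
  symm := ⟨fun _ _ h => ⟨h.1.symm, h.2.elim (fun e => Or.inl e.symm) (fun e => Or.inr e.symm)⟩⟩
  loopless := ⟨fun _ h => h.1 rfl⟩

/-- The antiprism triangulation of `Δ`. -/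
def antiprismTriangulation (Δ : AbstractSimplicialComplex V) :
    AbstractSimplicialComplex (PointedFace Δ) :=
  cliqueComplex (pointedFaceGraph Δ)

end Complexes

/-- The numbers `p k j`, for `0 ≤ k, j ≤ n`, transform the `h`-vector of every
`(n-1)`-dimensional finite simplicial complex into that of its antiprism triangulation. -/
def TransformsHVectors (n : ℕ) (p : ℕ → ℕ → ℤ) : Prop :=
  ∀ (V : Type u) [Finite V] (Δ : AbstractSimplicialComplex V), size Δ = n →
    ∀ j ≤ n, hNumber (antiprismTriangulation Δ) j =
      ∑ k ∈ Finset.range (n + 1), p k j * hNumber Δ k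

/-! ### Ordered set partitions -/

/-- The union of the sets in a list. -/
def unionOf (π : List (Finset ℕ)) : Finset ℕ := π.foldr (fun B U => B ∪ U) ∅

/-- `π` is an ordered set partition of `S`: a sequence of nonempty, pairwise disjoint sets with
union `S`. -/
structure IsOrderedPartition (π : List (Finset ℕ)) (S : Finset ℕ) : Prop where
  nonempty : ∀ B ∈ π, B.Nonempty
  disjoint : π.Pairwise Disjoint
  union_eq : unionOf π = S

/-- The block `B` is monochromatic, where `K` is the set of black elements and all other elements
are white. -/
def Monochromatic (K B : Finset ℕ) : Prop := B ⊆ K ∨ Disjoint B K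

/-- The triples `(S, π, K)` of a set `[k] ⊆ S ⊆ [n]`, an ordered set partition `π` of `S` and a
set `K` of `j` elements of `S`, colored black (the other elements of `S` being white), such that a
block of `π` can be monochromatic only if it is the first one, is contained in `[k]` and has all
its elements black. -/
def coloredPartitions (n k j : ℕ) : Set (Finset ℕ × List (Finset ℕ) × Finset ℕ) :=
  {t | Finset.Icc 1 k ⊆ t.1 ∧ t.1 ⊆ Finset.Icc 1 n ∧ IsOrderedPartition t.2.1 t.1 ∧
    t.2.2 ⊆ t.1 ∧ t.2.2.card = j ∧
    ∀ (i : ℕ) (hi : i < t.2.1.length), Monochromatic t.2.2 (t.2.1[i]'hi) →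
      i = 0 ∧ t.2.1[i]'hi ⊆ Finset.Icc 1 k ∧ t.2.1[i]'hi ⊆ t.2.2}

/-- The ordered set partitions `π = (B₁, …, Bₘ)` of `[n]` such that `B₁ ∪ ⋯ ∪ B_{⌊m/2⌋}` has `j`
elements if `m` is even, and such that the union of this set and of `Bₘ ∩ [k]` has `j` elements
if `m` is odd. -/
def halfUnionPartitions (n k j : ℕ) : Set (List (Finset ℕ)) :=
  {π | IsOrderedPartition π (Finset.Icc 1 n) ∧
    (Even π.length → (unionOf (π.take (π.length / 2))).card = j) ∧
    (Odd π.length →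
      (unionOf (π.take (π.length / 2)) ∪ (π.getLastD ∅ ∩ Finset.Icc 1 k)).card = j)}

end Antiprism

set_option linter.unusedSectionVars false

/-! All three families of numbers are read off from one identity in the commutative ring `SetFun` of
functions on finite sets under subset convolution. There an ordered product of functions vanishing
at `∅` enumerates weighted ordered set partitions (`sum_weight`), multiplicative functions multiply
by adding their weights (`mult_mul_mult`), and an `r`-th power of a function vanishing at `∅` is
zero on sets with fewer than `r` elements, so truncated geometric series invert `1 - bichromatic` on
`[n]`.

Write `P` for `powX`, `J` for `allOne`, `b = (P - 1) * (J - 1)` for `bichromatic`, and `A = [k]`. In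
(ii), lengths `2r` and `2r + 1` together contribute `b ^ r * powXInter A` (`prod_halfWeights`). In
(i), the sum over the number of blocks telescopes, and the uncolored complement of `S` turns `powXOn
A` into `powXInter A` (`sum_coloredGF`, `coloredGF_eq`). Both counts are therefore coefficients of
`powXInter A / (1 - b)` at `[n]`.

On the geometric side, a clique of pointed faces has a largest face `F`. Removing its layer over `F`
leaves a clique with largest face `F' ⊊ F` and a nonempty subset of `F \ F'` (`sum_cliquesOn`). This
recursion says that `simplexFun` is inverse to `1 - J + v`, where `v` gives each element weight `1 -
X` (`mul_simplexFun`). Grouping the faces of the triangulation by `F` and expressing the `f`-vector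
through the `h`-vector yields `transformPoly`. Since `P * v = J`, one has `1 - b = P * (1 - J + v)`,
which matches the two sides (`transformPoly_eq`).

Uniqueness holds because the `h`-vectors of the complexes of given dimension satisfy no nontrivial
linear relation (`eq_zero_of_sum_mul_hNumber`); disjoint unions of two simplices already show this.
-/

namespace Antiprism

/-! ### The ring of set functions -/

/-- Functions on the finite subsets of `α`, multiplied by
`(f * g) S = ∑ T ⊆ S, f T * g (S \ T)`. -/
def SetFun (α : Type*) (R : Type*) : Type _ := Finset α → R

namespace SetFun

variable {α R : Type*} [DecidableEq α] [CommRing R]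

instance : AddCommGroup (SetFun α R) := inferInstanceAs (AddCommGroup (Finset α → R))

instance : Mul (SetFun α R) := ⟨fun f g S => ∑ T ∈ S.powerset, f T * g (S \ T)⟩

instance : One (SetFun α R) := ⟨fun S => if S = ∅ then 1 else 0⟩

theorem mul_apply (f g : SetFun α R) (S : Finset α) :
    (f * g) S = ∑ T ∈ S.powerset, f T * g (S \ T) := rfl

theorem one_apply (S : Finset α) : (1 : SetFun α R) S = if S = ∅ then 1 else 0 := rfl

theorem add_apply (f g : SetFun α R) (S : Finset α) : (f + g) S = f S + g S := rfl

theorem sub_apply (f g : SetFun α R) (S : Finset α) : (f - g) S = f S - g S := rfl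

theorem zero_apply (S : Finset α) : (0 : SetFun α R) S = 0 := rfl

@[ext] theorem ext {f g : SetFun α R} (h : ∀ S, f S = g S) : f = g := funext h

theorem sum_apply {ι : Type*} (s : Finset ι) (f : ι → SetFun α R) (S : Finset α) :
    (∑ i ∈ s, f i) S = ∑ i ∈ s, f i S := Finset.sum_apply S s f

protected theorem mul_comm (f g : SetFun α R) : f * g = g * f := by
  ext S
  rw [mul_apply, mul_apply]
  refine Finset.sum_nbij' (fun T => S \ T) (fun T => S \ T) ?_ ?_ ?_ ?_ ?_
  · simp
  · simp
  · intro T hT; simpa using hT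
  · intro T hT; simpa using hT
  · intro T hT
    rw [Finset.sdiff_sdiff_eq_self (Finset.mem_powerset.mp hT), _root_.mul_comm]

protected theorem mul_assoc (f g h : SetFun α R) : f * g * h = f * (g * h) := by
  ext S
  simp only [mul_apply, Finset.sum_mul, Finset.mul_sum]
  rw [Finset.sum_sigma', Finset.sum_sigma']
  -- Both sides sum over splittings of `S` into three parts: a chain `B ⊆ A ⊆ S` corresponds to the
  -- first part `B` and the second part `A \ B`.
  refine Finset.sum_nbij' (fun p => ⟨p.2, p.1 \ p.2⟩) (fun p => ⟨p.1 ∪ p.2, p.1⟩) ?_ ?_ ?_ ?_ ?_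
  · rintro ⟨A, B⟩ h
    simp only [Finset.mem_sigma, Finset.mem_powerset] at h ⊢
    exact ⟨h.2.trans h.1, Finset.sdiff_subset_sdiff h.1 le_rfl⟩
  · rintro ⟨A, B⟩ h
    simp only [Finset.mem_sigma, Finset.mem_powerset] at h ⊢
    exact ⟨Finset.union_subset h.1 (h.2.trans Finset.sdiff_subset), Finset.subset_union_left⟩
  · rintro ⟨A, B⟩ h
    simp only [Finset.mem_sigma, Finset.mem_powerset] at h
    simp [Finset.union_eq_right.mpr h.2]
  · rintro ⟨A, B⟩ h
    simp only [Finset.mem_sigma, Finset.mem_powerset, Finset.subset_sdiff] at h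
    simp [Finset.union_sdiff_cancel_left h.2.2.symm]
  · rintro ⟨A, B⟩ h
    simp only [Finset.mem_sigma, Finset.mem_powerset] at h
    have : (S \ B) \ (A \ B) = S \ A := by
      ext i
      have := @h.2 i
      simp only [Finset.mem_sdiff]
      tauto
    simp only [this, _root_.mul_assoc]

protected theorem one_mul (f : SetFun α R) : 1 * f = f := by
  ext S
  rw [mul_apply, Finset.sum_eq_single ∅]
  · simp [one_apply]
  · intro T _ hT
    simp [one_apply, hT]
  · simp

protected theorem add_mul (f g h : SetFun α R) : (f + g) * h = f * h + g * h := by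
  ext S
  simp only [mul_apply, add_apply, _root_.add_mul, Finset.sum_add_distrib]

instance : CommRing (SetFun α R) :=
  { (inferInstance : AddCommGroup (SetFun α R)) with
    mul_assoc := SetFun.mul_assoc
    mul_comm := SetFun.mul_comm
    one_mul := SetFun.one_mul
    mul_one := fun f => by rw [SetFun.mul_comm, SetFun.one_mul]
    right_distrib := SetFun.add_mul
    left_distrib := fun f g h => by
      rw [SetFun.mul_comm f, SetFun.add_mul, SetFun.mul_comm g, SetFun.mul_comm h]
    zero_mul := fun f => by ext S; simp [mul_apply, zero_apply]
    mul_zero := fun f => by ext S; simp [mul_apply, zero_apply] }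

/-- The multiplicative set function `S ↦ ∏ i ∈ S, w i`. -/
def mult (w : α → R) : SetFun α R := fun S => ∏ i ∈ S, w i

theorem mult_apply (w : α → R) (S : Finset α) : mult w S = ∏ i ∈ S, w i := rfl

/-- Expanding `∏ (w i + v i)` chooses, for each element, one of the two summands, that is, a subset
and its complement. -/
theorem mult_mul_mult (w v : α → R) : mult w * mult v = mult (w + v) := by
  ext S
  simp only [mul_apply, mult_apply, Pi.add_apply, Finset.prod_add]

theorem mult_const_apply (c : R) (S : Finset α) : mult (fun _ => c) S = c ^ S.card := by
  simp [mult_apply]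

theorem mult_apply_empty (w : α → R) : mult w ∅ = 1 := by simp [mult_apply]

/-- A set with fewer than `r` elements cannot be split into `r` nonempty parts. This makes geometric
series finite on each set. -/
theorem pow_apply_eq_zero {f : SetFun α R} (hf : f ∅ = 0) {r : ℕ} {S : Finset α}
    (h : S.card < r) : (f ^ r) S = 0 := by
  induction r generalizing S with
  | zero => omega
  | succ r ih =>
    rw [pow_succ', mul_apply]
    refine Finset.sum_eq_zero fun T hT => ?_
    rcases T.eq_empty_or_nonempty with rfl | hne
    · rw [hf, zero_mul]
    · rw [ih, mul_zero]
      have := Finset.card_sdiff_add_card_eq_card (Finset.mem_powerset.mp hT)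
      have := hne.card_pos
      omega

theorem mul_apply_eq_zero {f : SetFun α R} {S : Finset α} (hf : ∀ T ⊆ S, f T = 0)
    (g : SetFun α R) : (f * g) S = 0 :=
  Finset.sum_eq_zero fun T hT => by rw [hf T (Finset.mem_powerset.mp hT), zero_mul]

theorem pow_mul_apply_eq_zero {f : SetFun α R} (hf : f ∅ = 0) {r : ℕ} {S : Finset α}
    (h : S.card < r) (g : SetFun α R) : (f ^ r * g) S = 0 :=
  mul_apply_eq_zero (fun _ hT => pow_apply_eq_zero hf ((Finset.card_le_card hT).trans_lt h)) g

end SetFun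

/-! ### Sums over ordered set partitions -/

section OrderedPartitions

theorem unionOf_cons (B : Finset ℕ) (π : List (Finset ℕ)) :
    unionOf (B :: π) = B ∪ unionOf π := rfl

theorem disjoint_unionOf {A : Finset ℕ} {π : List (Finset ℕ)} :
    Disjoint A (unionOf π) ↔ ∀ B ∈ π, Disjoint A B := by
  induction π with
  | nil => simp [unionOf]
  | cons B π ih => simp [unionOf_cons, Finset.disjoint_union_right, ih]

theorem isOrderedPartition_nil {S : Finset ℕ} : IsOrderedPartition [] S ↔ S = ∅ :=
  ⟨fun h => h.union_eq.symm, fun h => ⟨by simp, List.Pairwise.nil, h.symm⟩⟩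

theorem isOrderedPartition_cons {B S : Finset ℕ} {π : List (Finset ℕ)} :
    IsOrderedPartition (B :: π) S ↔ B.Nonempty ∧ B ⊆ S ∧ IsOrderedPartition π (S \ B) := by
  constructor
  · rintro ⟨h1, h2, h3⟩
    rw [List.pairwise_cons] at h2
    rw [unionOf_cons] at h3
    have hd := disjoint_unionOf.mpr h2.1
    refine ⟨h1 B (by simp), h3 ▸ Finset.subset_union_left,
      ⟨fun C hC => h1 C (by simp [hC]), h2.2, ?_⟩⟩
    rw [← h3, Finset.union_sdiff_cancel_left hd]
  · rintro ⟨h1, h2, h3⟩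
    refine ⟨fun C hC => ?_, List.pairwise_cons.mpr ⟨?_, h3.disjoint⟩, ?_⟩
    · rcases List.mem_cons.mp hC with rfl | hC
      exacts [h1, h3.nonempty C hC]
    · rw [← disjoint_unionOf, h3.union_eq]
      exact Finset.disjoint_sdiff
    · rw [unionOf_cons, h3.union_eq, Finset.union_sdiff_of_subset h2]

theorem IsOrderedPartition.length_le {π : List (Finset ℕ)} {S : Finset ℕ}
    (h : IsOrderedPartition π S) : π.length ≤ S.card := by
  induction π generalizing S with
  | nil => simp
  | cons B π ih =>
    obtain ⟨h1, h2, h3⟩ := isOrderedPartition_cons.mp h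
    have := ih h3
    have := Finset.card_sdiff_add_card_eq_card h2
    have := h1.card_pos
    simp only [List.length_cons]
    omega

/-- The ordered set partitions of `S` into `r` blocks. -/
def orderedPartitions : ℕ → Finset ℕ → Finset (List (Finset ℕ))
  | 0, S => if S = ∅ then {[]} else ∅
  | r + 1, S => (S.powerset.filter Finset.Nonempty).biUnion fun B =>
      (orderedPartitions r (S \ B)).image (B :: ·)

theorem mem_orderedPartitions {r : ℕ} {S : Finset ℕ} {π : List (Finset ℕ)} :
    π ∈ orderedPartitions r S ↔ IsOrderedPartition π S ∧ π.length = r := by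
  induction r generalizing S π with
  | zero =>
    rw [orderedPartitions, List.length_eq_zero_iff]
    constructor
    · intro h
      split_ifs at h with hS
      · rw [Finset.mem_singleton] at h
        exact ⟨h ▸ isOrderedPartition_nil.mpr hS, h⟩
      · simp at h
    · rintro ⟨h, rfl⟩
      simp [isOrderedPartition_nil.mp h]
  | succ r ih =>
    cases π with
    | nil => simp [orderedPartitions]
    | cons B π => simp [orderedPartitions, ih, isOrderedPartition_cons]; tauto

theorem sum_orderedPartitions_succ {M : Type*} [AddCommMonoid M] (r : ℕ) (S : Finset ℕ)
    (f : List (Finset ℕ) → M) :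
    ∑ π ∈ orderedPartitions (r + 1) S, f π =
      ∑ B ∈ S.powerset with B.Nonempty, ∑ π ∈ orderedPartitions r (S \ B), f (B :: π) := by
  rw [orderedPartitions, Finset.sum_biUnion]
  · refine Finset.sum_congr rfl fun B _ => ?_
    rw [Finset.sum_image]
    intro π _ ρ _ h
    exact (List.cons.inj h).2
  · intro B _ C _ hBC
    rw [Function.onFun, Finset.disjoint_left]
    intro π h1 h2
    obtain ⟨ρ, -, rfl⟩ := Finset.mem_image.mp h1
    obtain ⟨σ, -, h⟩ := Finset.mem_image.mp h2
    exact hBC (List.cons.inj h).1.symm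

variable {R : Type*} [CommRing R]

/-- The product of the values of the functions in a list on the corresponding blocks. -/
def weight (W : List (SetFun ℕ R)) (π : List (Finset ℕ)) : R :=
  (List.zipWith (fun w B => w B) W π).prod

theorem weight_cons (w : SetFun ℕ R) (W : List (SetFun ℕ R)) (B : Finset ℕ)
    (π : List (Finset ℕ)) : weight (w :: W) (B :: π) = w B * weight W π := by
  simp [weight]

theorem weight_append {W₁ : List (SetFun ℕ R)} {π₁ : List (Finset ℕ)}
    (h : W₁.length = π₁.length) (W₂ : List (SetFun ℕ R)) (π₂ : List (Finset ℕ)) :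
    weight (W₁ ++ W₂) (π₁ ++ π₂) = weight W₁ π₁ * weight W₂ π₂ := by
  rw [weight, List.zipWith_append h, List.prod_append]
  rfl

/-- The iterated convolution sums over all ordered splittings of `S`; vanishing at `∅` discards
those with an empty part. -/
theorem sum_weight {W : List (SetFun ℕ R)} (hW : ∀ w ∈ W, w ∅ = 0) (S : Finset ℕ) :
    ∑ π ∈ orderedPartitions W.length S, weight W π = W.prod S := by
  induction W generalizing S with
  | nil =>
    by_cases hS : S = ∅ <;> simp [orderedPartitions, hS, weight, SetFun.one_apply]
  | cons w W ih =>
    rw [List.length_cons, sum_orderedPartitions_succ, List.prod_cons, SetFun.mul_apply,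
      Finset.sum_filter]
    refine Finset.sum_congr rfl fun B _ => ?_
    split_ifs with hB
    · simp only [weight_cons, ← Finset.mul_sum]
      rw [ih fun w' hw' => hW w' (List.mem_cons_of_mem _ hw')]
    · rw [Finset.not_nonempty_iff_eq_empty.mp hB, hW w (by simp), zero_mul]

theorem sum_powerset_split {M : Type*} [AddCommMonoid M] {B S : Finset ℕ} (h : B ⊆ S)
    (f : Finset ℕ → Finset ℕ → M) :
    ∑ K ∈ S.powerset, f (K ∩ B) (K ∩ (S \ B)) =
      ∑ K₁ ∈ B.powerset, ∑ K₂ ∈ (S \ B).powerset, f K₁ K₂ := by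
  rw [← Finset.sum_product']
  refine Finset.sum_nbij' (fun K => (K ∩ B, K ∩ (S \ B))) (fun p => p.1 ∪ p.2) ?_ ?_ ?_ ?_ ?_
  · intro K _
    simp only [Finset.mem_product, Finset.mem_powerset]
    exact ⟨Finset.inter_subset_right, Finset.inter_subset_right⟩
  · rintro ⟨K₁, K₂⟩ hK
    simp only [Finset.mem_product, Finset.mem_powerset] at hK ⊢
    exact Finset.union_subset (hK.1.trans h) (hK.2.trans Finset.sdiff_subset)
  · intro K hK
    rw [Finset.mem_powerset] at hK
    ext i
    have := @hK i
    simp only [Finset.mem_union, Finset.mem_inter, Finset.mem_sdiff]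
    tauto
  · rintro ⟨K₁, K₂⟩ hK
    simp only [Finset.mem_product, Finset.mem_powerset] at hK
    ext i
    all_goals
      have h1 := @hK.1 i
      have h2 := @hK.2 i
      have h3 := @h i
      simp only [Finset.mem_sdiff] at h2
      simp only [Finset.mem_union, Finset.mem_inter, Finset.mem_sdiff]
      tauto
  · intro K _
    rfl

/-- The product of weights of the colored blocks, where `K` is the set of black elements. -/
def coloredWeight (C : List (Finset ℕ → Finset ℕ → R)) (π : List (Finset ℕ)) (K : Finset ℕ) : R :=
  (List.zipWith (fun c B => c B (K ∩ B)) C π).prod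

/-- The total weight of the colorings of a block. -/
def colorSum (c : Finset ℕ → Finset ℕ → R) : SetFun ℕ R := fun B => ∑ K ∈ B.powerset, c B K

theorem coloredWeight_congr {C : List (Finset ℕ → Finset ℕ → R)} {π : List (Finset ℕ)}
    {S : Finset ℕ} (h : IsOrderedPartition π S) (K : Finset ℕ) :
    coloredWeight C π (K ∩ S) = coloredWeight C π K := by
  induction C generalizing S π K with
  | nil => simp [coloredWeight]
  | cons c C ih =>
    cases π with
    | nil => simp [coloredWeight]
    | cons B π =>
      obtain ⟨-, h2, h3⟩ := isOrderedPartition_cons.mp h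
      have e := ih h3 (K ∩ S)
      rw [Finset.inter_assoc, Finset.inter_eq_right.mpr Finset.sdiff_subset, ih h3] at e
      simp only [coloredWeight, List.zipWith_cons_cons, List.prod_cons] at e ⊢
      rw [← e, Finset.inter_assoc, Finset.inter_eq_right.mpr h2]

/-- The blocks are colored independently, so the sum over colorings factors over the blocks. -/
theorem sum_coloredWeight (C : List (Finset ℕ → Finset ℕ → R)) {π : List (Finset ℕ)}
    {S : Finset ℕ} (h : IsOrderedPartition π S) (hl : C.length = π.length) :
    ∑ K ∈ S.powerset, coloredWeight C π K = weight (C.map colorSum) π := by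
  induction C generalizing S π with
  | nil =>
    obtain rfl : π = [] := List.length_eq_zero_iff.mp hl.symm
    obtain rfl := isOrderedPartition_nil.mp h
    simp [coloredWeight, weight]
  | cons c C ih =>
    cases π with
    | nil => simp at hl
    | cons B π =>
      obtain ⟨-, h2, h3⟩ := isOrderedPartition_cons.mp h
      have hl' : C.length = π.length := by simpa using hl
      rw [List.map_cons, weight_cons, ← ih h3 hl', colorSum, Finset.sum_mul_sum,
        ← sum_powerset_split h2 (fun K₁ K₂ => c B K₁ * coloredWeight C π K₂)]
      refine Finset.sum_congr rfl fun K _ => ?_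
      rw [coloredWeight_congr h3]
      simp [coloredWeight]

end OrderedPartitions

/-! ### The generating polynomial of the colored ordered partitions -/

section Colored

open Polynomial

/-- The set function `S ↦ X ^ |S|`. -/
noncomputable def powX : SetFun ℕ ℤ[X] := SetFun.mult fun _ => X

/-- The constant set function `1`. -/
noncomputable def allOne : SetFun ℕ ℤ[X] := SetFun.mult fun _ => 1

/-- The generating polynomial of the colorings of a set which are not monochromatic. -/
noncomputable def bichromatic : SetFun ℕ ℤ[X] := (powX - 1) * (allOne - 1)

/-- The set function that sends `S` to `X ^ |S|` if `S ⊆ A` and to zero otherwise. -/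
noncomputable def powXOn (A : Finset ℕ) : SetFun ℕ ℤ[X] :=
  SetFun.mult fun i => if i ∈ A then X else 0

theorem powX_apply (S : Finset ℕ) : powX S = X ^ S.card := SetFun.mult_const_apply X S

theorem allOne_apply (S : Finset ℕ) : allOne S = 1 := by
  rw [allOne, SetFun.mult_const_apply, one_pow]

theorem mult_ite_zero_apply (A S : Finset ℕ) (c : ℤ[X]) :
    SetFun.mult (fun i => if i ∈ A then c else 0) S = if S ⊆ A then c ^ S.card else 0 := by
  rw [SetFun.mult_apply]
  split_ifs with h
  · rw [Finset.prod_congr rfl fun i hi => if_pos (h hi), Finset.prod_const]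
  · obtain ⟨i, hi, hA⟩ := Finset.not_subset.mp h
    exact Finset.prod_eq_zero hi (if_neg hA)

theorem mult_zero_ite_apply (A S : Finset ℕ) (c : ℤ[X]) :
    SetFun.mult (fun i => if i ∈ A then 0 else c) S = if Disjoint S A then c ^ S.card else 0 := by
  rw [SetFun.mult_apply]
  split_ifs with h
  · rw [Finset.prod_congr rfl fun i hi => if_neg (Finset.disjoint_left.mp h hi), Finset.prod_const]
  · obtain ⟨i, hi, hA⟩ := Finset.not_disjoint_iff.mp h
    exact Finset.prod_eq_zero hi (if_pos hA)

theorem powXOn_apply (A S : Finset ℕ) : powXOn A S = if S ⊆ A then X ^ S.card else 0 :=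
  mult_ite_zero_apply A S X

theorem powX_mul_allOne_apply (S : Finset ℕ) :
    (powX * allOne) S = ∑ K ∈ S.powerset, X ^ K.card := by
  simp only [SetFun.mul_apply, powX_apply, allOne_apply, mul_one]

theorem bichromatic_empty : bichromatic ∅ = 0 := by
  rw [bichromatic, SetFun.mul_apply]
  simp [SetFun.sub_apply, SetFun.one_apply, powX_apply]

open scoped Classical in
/-- The weight of a colored block which must not be monochromatic. -/
noncomputable def laterBlockWeight (B K : Finset ℕ) : ℤ[X] :=
  if Monochromatic K B then 0 else X ^ K.card

open scoped Classical in
/-- The weight of a nonempty colored block which, if it is monochromatic, must be black and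
contained in `A`. -/
noncomputable def firstBlockWeight (A B K : Finset ℕ) : ℤ[X] :=
  if B.Nonempty ∧ (Monochromatic K B → B ⊆ A ∧ B ⊆ K) then X ^ K.card else 0

theorem monochromatic_inter {K B : Finset ℕ} : Monochromatic (K ∩ B) B ↔ Monochromatic K B := by
  simp only [Monochromatic, Finset.subset_inter_iff, Finset.disjoint_iff_inter_eq_empty, le_refl,
    and_true, ← Finset.inter_assoc, Finset.inter_comm B K]
  rw [Finset.inter_assoc K B B, Finset.inter_self]

theorem monochromatic_iff_of_subset {K B : Finset ℕ} (h : K ⊆ B) :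
    Monochromatic K B ↔ K = B ∨ K = ∅ := by
  rw [Monochromatic, Finset.disjoint_iff_inter_eq_empty, Finset.inter_eq_right.mpr h]
  exact or_congr_left ⟨fun h' => h.antisymm h', fun h' => h'.ge⟩

/-- From all colorings, counted by `powX * allOne`, the all-black and the all-white one are removed;
the final `+ 1` corrects the empty set, where these coincide. -/
theorem colorSum_laterBlockWeight : colorSum laterBlockWeight = bichromatic := by
  ext1 B
  have e : bichromatic = powX * allOne - powX - allOne + 1 := by rw [bichromatic]; ring
  rcases B.eq_empty_or_nonempty with rfl | hB
  · rw [bichromatic_empty]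
    simp [colorSum, laterBlockWeight, Monochromatic]
  · rw [e, SetFun.add_apply, SetFun.sub_apply, SetFun.sub_apply, powX_mul_allOne_apply, powX_apply,
      allOne_apply, SetFun.one_apply, if_neg hB.ne_empty, colorSum]
    have : ∀ K ∈ B.powerset, laterBlockWeight B K =
        X ^ K.card - (if K = B then X ^ B.card else 0) - (if K = ∅ then 1 else 0) := by
      intro K hK
      rw [laterBlockWeight, monochromatic_iff_of_subset (Finset.mem_powerset.mp hK)]
      by_cases h1 : K = B
      · subst h1; simp [hB.ne_empty]
      · by_cases h2 : K = ∅
        · subst h2; simp [hB.ne_empty.symm]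
        · simp [h1, h2]
    rw [Finset.sum_congr rfl this]
    simp

/-- Only the all-black coloring of a block inside `A` is readmitted; `- 1` cancels the value of
`powXOn A` at `∅`. -/
theorem colorSum_firstBlockWeight (A : Finset ℕ) :
    colorSum (firstBlockWeight A) = bichromatic + powXOn A - 1 := by
  ext1 B
  rw [SetFun.sub_apply, SetFun.add_apply, ← colorSum_laterBlockWeight, powXOn_apply,
    SetFun.one_apply]
  rcases B.eq_empty_or_nonempty with rfl | hB
  · simp [colorSum, laterBlockWeight, firstBlockWeight, Monochromatic]
  · rw [if_neg hB.ne_empty, sub_zero, colorSum, colorSum]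
    have : ∀ K ∈ B.powerset, firstBlockWeight A B K = laterBlockWeight B K +
        (if K = B then (if B ⊆ A then X ^ B.card else 0) else 0) := by
      intro K hK
      rw [Finset.mem_powerset] at hK
      rw [laterBlockWeight, firstBlockWeight, monochromatic_iff_of_subset hK]
      by_cases h1 : K = B
      · subst h1; simp [hB]
      · by_cases h2 : K = ∅
        · subst h2; simp [hB.ne_empty.symm, hB.ne_empty, hB]
        · simp [h1, h2, hB]
    rw [Finset.sum_congr rfl this]
    simp [Finset.sum_add_distrib]

theorem card_inter_cons {B S K : Finset ℕ} (h : B ⊆ S) :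
    (K ∩ S).card = (K ∩ B).card + (K ∩ (S \ B)).card := by
  rw [← Finset.card_union_of_disjoint, ← Finset.inter_union_distrib_left,
    Finset.union_sdiff_of_subset h]
  exact Finset.disjoint_sdiff.mono Finset.inter_subset_right Finset.inter_subset_right

open scoped Classical in
theorem coloredWeight_replicate {π : List (Finset ℕ)} {S : Finset ℕ}
    (h : IsOrderedPartition π S) (K : Finset ℕ) :
    coloredWeight (List.replicate π.length laterBlockWeight) π K =
      if ∀ B ∈ π, ¬ Monochromatic K B then X ^ (K ∩ S).card else 0 := by
  induction π generalizing S with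
  | nil =>
    obtain rfl := isOrderedPartition_nil.mp h
    simp [coloredWeight]
  | cons B π ih =>
    obtain ⟨-, h2, h3⟩ := isOrderedPartition_cons.mp h
    have e : coloredWeight (List.replicate (B :: π).length laterBlockWeight) (B :: π) K =
        laterBlockWeight B (K ∩ B) *
          coloredWeight (List.replicate π.length laterBlockWeight) π K := by
      simp [coloredWeight, List.replicate_succ]
    rw [e, ih h3, laterBlockWeight, monochromatic_inter, card_inter_cons h2, pow_add]
    simp only [List.forall_mem_cons]
    by_cases h4 : Monochromatic K B <;> simp [h4]

/-- The weights of the blocks of a colored ordered partition. -/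
noncomputable def blockWeights (A : Finset ℕ) : ℕ → List (Finset ℕ → Finset ℕ → ℤ[X])
  | 0 => []
  | r + 1 => firstBlockWeight A :: List.replicate r laterBlockWeight

theorem length_blockWeights (A : Finset ℕ) (r : ℕ) : (blockWeights A r).length = r := by
  cases r <;> simp [blockWeights]

/-- The condition on the monochromatic blocks of a colored ordered partition. -/
def IsGoodColoring (A : Finset ℕ) (π : List (Finset ℕ)) (K : Finset ℕ) : Prop :=
  ∀ (i : ℕ) (hi : i < π.length), Monochromatic K (π[i]'hi) →
      i = 0 ∧ π[i]'hi ⊆ A ∧ π[i]'hi ⊆ K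

theorem isGoodColoring_cons {A B K : Finset ℕ} {π : List (Finset ℕ)} :
    IsGoodColoring A (B :: π) K ↔
      (Monochromatic K B → B ⊆ A ∧ B ⊆ K) ∧ ∀ C ∈ π, ¬ Monochromatic K C := by
  constructor
  · intro h
    refine ⟨fun hB => (h 0 (by simp) hB).2, fun C hC hK => ?_⟩
    obtain ⟨i, hi, rfl⟩ := List.getElem_of_mem hC
    have := (h (i + 1) (by simpa using hi) (by simpa using hK)).1
    omega
  · rintro ⟨h1, h2⟩ i hi hK
    cases i with
    | zero => exact ⟨rfl, h1 hK⟩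
    | succ i => exact absurd hK (h2 _ (by simp))

open scoped Classical in
theorem coloredWeight_blockWeights (A : Finset ℕ) {π : List (Finset ℕ)} {S : Finset ℕ}
    (h : IsOrderedPartition π S) {K : Finset ℕ} (hK : K ⊆ S) :
    coloredWeight (blockWeights A π.length) π K =
      if IsGoodColoring A π K then X ^ K.card else 0 := by
  rw [← Finset.inter_eq_left] at hK
  cases π with
  | nil =>
    obtain rfl := isOrderedPartition_nil.mp h
    obtain rfl : ∅ = K := by simpa using hK
    simp [coloredWeight, IsGoodColoring]
  | cons B π =>
    obtain ⟨h1, h2, h3⟩ := isOrderedPartition_cons.mp h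
    have e : coloredWeight (blockWeights A (B :: π).length) (B :: π) K =
        firstBlockWeight A B (K ∩ B) *
          coloredWeight (List.replicate π.length laterBlockWeight) π K := by
      simp [coloredWeight, blockWeights]
    rw [e, coloredWeight_replicate h3, firstBlockWeight, monochromatic_inter, ← hK,
      card_inter_cons h2, hK, pow_add, isGoodColoring_cons]
    simp only [Finset.subset_inter_iff, Finset.Subset.refl, and_true]
    by_cases h5 : ∀ C ∈ π, ¬ Monochromatic K C
    · rw [if_pos h5]
      simp only [h1, true_and, and_iff_left h5, ite_mul, zero_mul]
    · simp only [h5, and_false, if_false, mul_zero]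

/-- The generating polynomial of the colored ordered partitions of a set into `r` blocks. -/
noncomputable def coloredGF (A : Finset ℕ) : ℕ → SetFun ℕ ℤ[X]
  | 0 => 1
  | r + 1 => (bichromatic + powXOn A - 1) * bichromatic ^ r

theorem sum_coloredWeight_blockWeights (A : Finset ℕ) (r : ℕ) (S : Finset ℕ) :
    ∑ π ∈ orderedPartitions r S, ∑ K ∈ S.powerset, coloredWeight (blockWeights A r) π K =
      coloredGF A r S := by
  have h1 : ∀ π ∈ orderedPartitions r S,
      ∑ K ∈ S.powerset, coloredWeight (blockWeights A r) π K =
        weight ((blockWeights A r).map colorSum) π := fun π hπ => by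
    obtain ⟨h, hl⟩ := mem_orderedPartitions.mp hπ
    exact sum_coloredWeight _ h (by rw [length_blockWeights, hl])
  have h2 : ((blockWeights A r).map colorSum).length = r := by simp [length_blockWeights]
  have h3 := sum_weight (W := (blockWeights A r).map colorSum) ?_ S
  · rw [h2] at h3
    rw [Finset.sum_congr rfl h1, h3]
    cases r with
    | zero => simp [blockWeights, coloredGF]
    | succ r =>
      simp [blockWeights, coloredGF, colorSum_laterBlockWeight, colorSum_firstBlockWeight]
  · have e1 : colorSum laterBlockWeight ∅ = 0 := by
      rw [colorSum_laterBlockWeight, bichromatic_empty]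
    have e2 : colorSum (firstBlockWeight A) ∅ = 0 := by
      simp [colorSum, firstBlockWeight]
    intro w hw
    cases r with
    | zero => simp [blockWeights] at hw
    | succ r =>
      simp only [blockWeights, List.map_cons, List.map_replicate, List.mem_cons,
        List.mem_replicate] at hw
      rcases hw with rfl | ⟨-, rfl⟩
      exacts [e2, e1]

theorem mem_orderedPartitions_biUnion {n : ℕ} {S : Finset ℕ} (hS : S ⊆ Finset.Icc 1 n)
    {π : List (Finset ℕ)} :
    π ∈ (Finset.range (n + 2)).biUnion (orderedPartitions · S) ↔ IsOrderedPartition π S := by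
  simp only [Finset.mem_biUnion, Finset.mem_range, mem_orderedPartitions]
  constructor
  · rintro ⟨r, -, h, -⟩
    exact h
  · intro h
    have := Finset.card_le_card hS
    rw [Nat.card_Icc] at this
    exact ⟨π.length, by have := h.length_le; omega, h, rfl⟩

theorem pairwiseDisjoint_orderedPartitions (s : Set ℕ) (S : Finset ℕ) :
    s.PairwiseDisjoint (orderedPartitions · S) := by
  intro r _ r' _ h
  rw [Function.onFun, Finset.disjoint_left]
  intro π h1 h2
  exact h ((mem_orderedPartitions.mp h1).2.symm.trans (mem_orderedPartitions.mp h2).2)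

open scoped Classical in
-- The last factor is evaluated at `[n] \ S`, where it is the indicator of `[k] ⊆ S`. Up to `n`
-- blocks can occur; the extra term in the range is harmless and suits the index shift in
-- `sum_coloredGF`.
theorem ncard_coloredPartitions {n k : ℕ} (hk : k ≤ n) (j : ℕ) :
    ((coloredPartitions n k j).ncard : ℤ) =
      (((∑ r ∈ Finset.range (n + 2), coloredGF (Finset.Icc 1 k) r) *
        SetFun.mult fun i => if i ∈ Finset.Icc 1 k then 0 else 1 : SetFun ℕ ℤ[X])
          (Finset.Icc 1 n)).coeff j := by
  set A := Finset.Icc 1 k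
  set Q : Finset ℕ → Finset (List (Finset ℕ)) :=
    fun S => (Finset.range (n + 2)).biUnion (orderedPartitions · S)
  set T : Finset (Σ _ : Finset ℕ, List (Finset ℕ) × Finset ℕ) :=
    ((Finset.Icc 1 n).powerset.filter (A ⊆ ·)).sigma
      (fun S => (Q S ×ˢ S.powerset).filter fun p => IsGoodColoring A p.1 p.2 ∧ p.2.card = j)
  have e1 : coloredPartitions n k j =
      (T.image fun s => (s.1, s.2.1, s.2.2) : Finset (Finset ℕ × List (Finset ℕ) × Finset ℕ)) := by
    ext ⟨S, π, K⟩
    simp only [coloredPartitions, Set.mem_ofPred_eq, Finset.coe_image, Set.mem_image, T, Q,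
      Finset.mem_coe, Finset.mem_sigma, Finset.mem_filter, Finset.mem_powerset, Finset.mem_product,
      Prod.mk.injEq]
    constructor
    · rintro ⟨h1, h2, h3, h4, h5, h6⟩
      exact ⟨⟨S, π, K⟩, ⟨⟨h2, h1⟩, ⟨(mem_orderedPartitions_biUnion h2).mpr h3, h4⟩, h6, h5⟩,
        rfl, rfl, rfl⟩
    · rintro ⟨⟨S', π', K'⟩, ⟨⟨h2, h1⟩, ⟨h3, h4⟩, h6, h5⟩, rfl, rfl, rfl⟩
      exact ⟨h1, h2, (mem_orderedPartitions_biUnion h2).mp h3, h4, h5, h6⟩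
  rw [e1, Set.ncard_coe_finset, Finset.card_image_of_injective, Finset.card_sigma, SetFun.mul_apply,
    Finset.sum_filter, finsetSum_coeff]
  · push_cast
    refine Finset.sum_congr rfl fun S hS => ?_
    rw [Finset.mem_powerset] at hS
    rw [mult_zero_ite_apply, one_pow]
    have e2 : Disjoint (Finset.Icc 1 n \ S) A ↔ A ⊆ S := by
      simp only [A, Finset.subset_iff, Finset.disjoint_left, Finset.mem_sdiff, Finset.mem_Icc]
      constructor
      · intro h i hi
        by_contra hi'
        exact h ⟨⟨hi.1, hi.2.trans hk⟩, hi'⟩ hi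
      · exact fun h i hi hi' => hi.2 (h hi')
    by_cases hA : A ⊆ S
    · rw [if_pos hA, if_pos (e2.mpr hA), mul_one, SetFun.sum_apply, Finset.card_filter,
        Finset.sum_product, Finset.sum_biUnion (pairwiseDisjoint_orderedPartitions _ _),
        finsetSum_coeff]
      push_cast
      refine Finset.sum_congr rfl fun r _ => ?_
      rw [← sum_coloredWeight_blockWeights, finsetSum_coeff]
      refine Finset.sum_congr rfl fun π hπ => ?_
      obtain ⟨hP, rfl⟩ := mem_orderedPartitions.mp hπ
      rw [finsetSum_coeff]
      refine Finset.sum_congr rfl fun K hK => ?_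
      rw [coloredWeight_blockWeights A hP (Finset.mem_powerset.mp hK)]
      by_cases hg : IsGoodColoring A π K
      · simp [hg, coeff_X_pow, eq_comm]
      · simp [hg]
    · rw [if_neg hA, if_neg (e2.not.mpr hA), mul_zero, coeff_zero]
  · rintro ⟨S, π, K⟩ ⟨S', π', K'⟩ h
    simp only [Prod.mk.injEq] at h
    obtain ⟨rfl, rfl, rfl⟩ := h
    rfl

end Colored

/-! ### The generating polynomial of `halfUnionPartitions` -/

section HalfUnion

open Polynomial

/-- The set function `S ↦ X ^ |S ∩ A|`. -/
noncomputable def powXInter (A : Finset ℕ) : SetFun ℕ ℤ[X] :=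
  SetFun.mult fun i => if i ∈ A then X else 1

theorem powXInter_apply (A S : Finset ℕ) : powXInter A S = X ^ (S ∩ A).card := by
  rw [powXInter, SetFun.mult_apply, Finset.prod_ite, Finset.prod_const_one, mul_one,
    Finset.prod_const, Finset.filter_mem_eq_inter]

theorem sub_one_apply_of_nonempty (f : SetFun ℕ ℤ[X]) {B : Finset ℕ} (hB : B.Nonempty) :
    (f - 1) B = f B := by
  rw [SetFun.sub_apply, SetFun.one_apply, if_neg hB.ne_empty, sub_zero]

theorem weight_replicate_powX {π : List (Finset ℕ)} {S : Finset ℕ}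
    (h : IsOrderedPartition π S) :
    weight (List.replicate π.length (powX - 1)) π = X ^ S.card := by
  induction π generalizing S with
  | nil => simp [isOrderedPartition_nil.mp h, weight]
  | cons B π ih =>
    obtain ⟨h1, h2, h3⟩ := isOrderedPartition_cons.mp h
    rw [List.length_cons, List.replicate_succ, weight_cons, ih h3, sub_one_apply_of_nonempty _ h1,
      powX_apply, ← pow_add, add_comm, Finset.card_sdiff_add_card_eq_card h2]

theorem weight_replicate_allOne {π : List (Finset ℕ)} {S : Finset ℕ}
    (h : IsOrderedPartition π S) :
    weight (List.replicate π.length (allOne - 1)) π = 1 := by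
  induction π generalizing S with
  | nil => simp [weight]
  | cons B π ih =>
    obtain ⟨h1, h2, h3⟩ := isOrderedPartition_cons.mp h
    rw [List.length_cons, List.replicate_succ, weight_cons, ih h3, sub_one_apply_of_nonempty _ h1,
      allOne_apply, one_mul]

theorem IsOrderedPartition.sublist {π ρ : List (Finset ℕ)} {S : Finset ℕ}
    (h : IsOrderedPartition π S) (hρ : ρ.Sublist π) : IsOrderedPartition ρ (unionOf ρ) :=
  ⟨fun B hB => h.nonempty B (hρ.subset hB), h.disjoint.sublist hρ, rfl⟩

/-- The weights of the blocks of an ordered partition of length `m`. -/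
noncomputable def halfWeights (A : Finset ℕ) (m : ℕ) : List (SetFun ℕ ℤ[X]) :=
  List.replicate (m / 2) (powX - 1) ++ List.replicate (m / 2) (allOne - 1) ++
    if Even m then [] else [powXInter A - 1]

theorem length_halfWeights (A : Finset ℕ) (m : ℕ) : (halfWeights A m).length = m := by
  rcases Nat.even_or_odd' m with ⟨r, rfl | rfl⟩
  · simp [halfWeights]; omega
  · simp [halfWeights]; omega

/-- The condition on the blocks in `halfUnionPartitions`. -/
def HalfUnionCard (A : Finset ℕ) (j : ℕ) (π : List (Finset ℕ)) : Prop :=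
  (Even π.length → (unionOf (π.take (π.length / 2))).card = j) ∧
    (Odd π.length → (unionOf (π.take (π.length / 2)) ∪ (π.getLastD ∅ ∩ A)).card = j)

open scoped Classical in
-- Elements of the first half of the blocks carry `X`, those of the second half carry `1`, and an
-- odd last block carries `X` exactly on `A`. The blocks are disjoint, so exponents add up to the
-- cardinality of the union.
theorem coeff_weight_halfWeights (A : Finset ℕ) {π : List (Finset ℕ)} {S : Finset ℕ}
    (h : IsOrderedPartition π S) (j : ℕ) :
    (weight (halfWeights A π.length) π).coeff j = if HalfUnionCard A j π then 1 else 0 := by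
  rcases Nat.even_or_odd' π.length with ⟨r, hr | hr⟩
  · obtain ⟨α, β, rfl, hα, hβ⟩ : ∃ α β, π = α ++ β ∧ α.length = r ∧ β.length = r :=
      ⟨π.take r, π.drop r, (List.take_append_drop r π).symm, by simp; omega, by simp; omega⟩
    have e : HalfUnionCard A j (α ++ β) ↔ j = (unionOf α).card := by
      rw [HalfUnionCard, hr]
      have : 2 * r / 2 = α.length := by omega
      simp only [this, List.take_left, even_two_mul, forall_true_left, ← Nat.not_even_iff_odd,
        not_true_eq_false, false_imp_iff, and_true, eq_comm]
    have e2 : halfWeights A (α ++ β).length =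
        List.replicate α.length (powX - 1) ++ List.replicate β.length (allOne - 1) := by
      have : 2 * r / 2 = r := by omega
      rw [halfWeights, hr, hα, hβ, this, if_pos (even_two_mul r), List.append_nil]
    rw [e2, weight_append (by simp), weight_replicate_powX (h.sublist (List.sublist_append_left ..)),
      weight_replicate_allOne (h.sublist (List.sublist_append_right ..)), mul_one, coeff_X_pow]
    simp only [e]
  · obtain ⟨α, β, B, rfl, hα, hβ⟩ :
        ∃ α β B, π = α ++ β ++ [B] ∧ α.length = r ∧ β.length = r := by
      have hne : π ≠ [] := by rintro rfl; simp at hr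
      refine ⟨π.dropLast.take r, π.dropLast.drop r, π.getLast hne, ?_, ?_, ?_⟩
      · rw [List.take_append_drop, List.dropLast_append_getLast]
      · simp; omega
      · simp; omega
    have hodd : ¬ Even (2 * r + 1) := by simp
    have hdiv : (2 * r + 1) / 2 = r := by omega
    have hd : Disjoint (unionOf α) (B ∩ A) := by
      have h1 := (List.pairwise_append.mp h.disjoint).2.2
      refine Disjoint.mono_right Finset.inter_subset_left (Disjoint.symm ?_)
      rw [disjoint_unionOf]
      exact fun C hC => (h1 C (by simp [hC]) B (by simp)).symm
    have e : HalfUnionCard A j (α ++ β ++ [B]) ↔ j = (unionOf α).card + (B ∩ A).card := by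
      rw [HalfUnionCard, hr, hdiv, List.append_assoc, List.take_left' hα, ← List.append_assoc,
        List.getLastD_concat, Finset.card_union_of_disjoint hd]
      simp only [hodd, false_imp_iff, true_and, Nat.not_even_iff_odd.mp hodd, forall_true_left,
        eq_comm]
    have e2 : halfWeights A (α ++ β ++ [B]).length =
        List.replicate α.length (powX - 1) ++ List.replicate β.length (allOne - 1) ++
          [powXInter A - 1] := by
      rw [halfWeights, hr, hα, hβ, hdiv, if_neg hodd]
    have hB : B.Nonempty := h.nonempty B (by simp)
    rw [e2, weight_append (by simp), weight_append (by simp), weight_replicate_powX (h.sublist ?_),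
      weight_replicate_allOne (h.sublist ?_), mul_one]
    · simp only [e]
      simp [weight, sub_one_apply_of_nonempty _ hB, powXInter_apply, ← pow_add, coeff_X_pow]
    · exact (List.sublist_append_right ..).trans (List.sublist_append_left ..)
    · exact (List.sublist_append_left ..).trans (List.sublist_append_left ..)

theorem sum_range_two_mul {M : Type*} [AddCommMonoid M] (f : ℕ → M) (n : ℕ) :
    ∑ m ∈ Finset.range (2 * n), f m = ∑ r ∈ Finset.range n, (f (2 * r) + f (2 * r + 1)) := by
  induction n with
  | zero => simp
  | succ n ih =>
    rw [Finset.sum_range_succ, ← ih, Nat.mul_succ, Finset.sum_range_succ, Finset.sum_range_succ,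
      add_assoc]

/-- The factors pair up to `bichromatic ^ r` for even length and `bichromatic ^ r * (powXInter A -
1)` for odd length. -/
theorem prod_halfWeights (A : Finset ℕ) (r : ℕ) :
    (halfWeights A (2 * r)).prod + (halfWeights A (2 * r + 1)).prod =
      bichromatic ^ r * powXInter A := by
  have h1 : 2 * r / 2 = r := by omega
  have h2 : (2 * r + 1) / 2 = r := by omega
  simp only [halfWeights, h1, h2, even_two_mul, if_true, List.prod_append, List.prod_replicate,
    List.prod_nil, Nat.not_even_bit1, if_false, List.prod_singleton, bichromatic, mul_pow]
  ring

theorem ncard_halfUnionPartitions (n k j : ℕ) :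
    ((halfUnionPartitions n k j).ncard : ℤ) =
      (((∑ r ∈ Finset.range (n + 1), bichromatic ^ r) * powXInter (Finset.Icc 1 k) :
        SetFun ℕ ℤ[X]) (Finset.Icc 1 n)).coeff j := by
  classical
  set A := Finset.Icc 1 k
  set S := Finset.Icc 1 n
  -- Lengths above `n` do not occur; the range extends to `2n + 1` so that lengths group into pairs
  -- `2r`, `2r + 1`.
  have e1 : halfUnionPartitions n k j =
      (((Finset.range (2 * (n + 1))).biUnion (orderedPartitions · S)).filter
        (HalfUnionCard A j) : Finset (List (Finset ℕ))) := by
    ext π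
    simp only [halfUnionPartitions, Set.mem_ofPred_eq, Finset.mem_coe, Finset.mem_filter,
      Finset.mem_biUnion, Finset.mem_range, mem_orderedPartitions]
    constructor
    · rintro ⟨h1, h2⟩
      have := h1.length_le
      rw [Nat.card_Icc] at this
      exact ⟨⟨π.length, by omega, h1, rfl⟩, h2⟩
    · rintro ⟨⟨m, -, h1, -⟩, h2⟩
      exact ⟨h1, h2⟩
  have h0 : ∀ m, ∀ w ∈ halfWeights A m, w ∅ = 0 := by
    intro m w hw
    have e : ∀ v : ℕ → ℤ[X], (SetFun.mult v - 1) ∅ = 0 := fun v => by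
      rw [SetFun.sub_apply, SetFun.mult_apply_empty, SetFun.one_apply, if_pos rfl, sub_self]
    simp only [halfWeights, List.mem_append, List.mem_replicate] at hw
    rcases hw with (⟨-, rfl⟩ | ⟨-, rfl⟩) | hw
    · exact e _
    · exact e _
    · split_ifs at hw
      · simp at hw
      · rw [List.mem_singleton] at hw
        exact hw ▸ e _
  rw [e1, Set.ncard_coe_finset, Finset.card_filter,
    Finset.sum_biUnion (pairwiseDisjoint_orderedPartitions _ _), Finset.sum_mul]
  simp only [← prod_halfWeights]
  rw [← sum_range_two_mul fun m => (halfWeights A m).prod, SetFun.sum_apply, finsetSum_coeff]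
  push_cast
  refine Finset.sum_congr rfl fun m _ => ?_
  have h1 := sum_weight (h0 m) S
  rw [length_halfWeights] at h1
  rw [← h1, finsetSum_coeff]
  refine Finset.sum_congr rfl fun π hπ => ?_
  obtain ⟨h2, rfl⟩ := mem_orderedPartitions.mp hπ
  rw [coeff_weight_halfWeights A h2]

end HalfUnion

/-! ### The transformation polynomials -/

section Transform

open Polynomial

/-- The part `(bichromatic - 1) * ∑ bichromatic ^ r` telescopes, and its `-1` cancels the term for
zero blocks. -/
theorem sum_coloredGF (A : Finset ℕ) (n : ℕ) :
    ∑ r ∈ Finset.range (n + 1), coloredGF A r =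
      bichromatic ^ n + powXOn A * ∑ r ∈ Finset.range n, bichromatic ^ r := by
  rw [Finset.sum_range_succ']
  simp only [coloredGF]
  rw [← Finset.mul_sum]
  linear_combination mul_geom_sum bichromatic n

/-- The weights `X` on `A` and `1` off `A` add up to those of `powXInter A`, and the leftover power
`bichromatic ^ (n + 1)` vanishes on `S`. -/
theorem coloredGF_eq (A S : Finset ℕ) {n : ℕ} (hS : S.card ≤ n) :
    ((∑ r ∈ Finset.range (n + 2), coloredGF A r) *
        SetFun.mult fun i => if i ∈ A then 0 else 1 : SetFun ℕ ℤ[X]) S =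
      ((∑ r ∈ Finset.range (n + 1), bichromatic ^ r) * powXInter A : SetFun ℕ ℤ[X]) S := by
  have h : powXOn A * SetFun.mult (fun i => if i ∈ A then 0 else 1) = powXInter A := by
    rw [powXOn, SetFun.mult_mul_mult, powXInter]
    congr 1
    ext1 i
    by_cases hi : i ∈ A <;> simp [hi]
  rw [sum_coloredGF, add_mul, SetFun.add_apply,
    SetFun.pow_mul_apply_eq_zero bichromatic_empty (by omega), zero_add, mul_right_comm, h, mul_comm]

/-- The generating polynomial of the faces of the antiprism triangulation of an
`(m - 1)`-dimensional simplex which are not contained in the boundary: it is the sum of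
`X ^ |C| * (1 - X) ^ (m - |C|)` over all these faces `C`. -/
noncomputable def simplexPoly : ℕ → ℤ[X]
  | 0 => 1
  | m + 1 => ∑ l : Fin (m + 1), (m + 1).choose l • (simplexPoly l * (1 - (1 - X) ^ (m + 1 - l)))

/-- The added term `l = m` is zero because `1 - (1 - X) ^ 0 = 0`; with it, the recursion becomes a
convolution over all subsets. -/
theorem simplexPoly_eq {m : ℕ} (hm : m ≠ 0) :
    simplexPoly m =
      ∑ l ∈ Finset.range (m + 1), m.choose l • (simplexPoly l * (1 - (1 - X) ^ (m - l))) := by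
  obtain ⟨m, rfl⟩ := Nat.exists_eq_succ_of_ne_zero hm
  rw [Finset.sum_range_succ, simplexPoly, Finset.sum_range]
  simp

/-- `∑ j, p(n, k, j) X ^ j`, where `p(n, k, j)` are the coefficients of the transformation of the
`h`-vector. -/
noncomputable def transformPoly (n k : ℕ) : ℤ[X] :=
  ∑ l ∈ Finset.range (n - k + 1), (n - k).choose l • ((1 - X) ^ l * simplexPoly (n - l))

/-- The set function `S ↦ simplexPoly |S|`. -/
noncomputable def simplexFun : SetFun ℕ ℤ[X] := fun S => simplexPoly S.card

/-- This is the recursion for `simplexPoly`, read as `simplexFun * (allOne - v) = simplexFun - 1`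
with `v` the multiplicative function of weight `1 - X`. -/
theorem mul_simplexFun :
    (1 - allOne + SetFun.mult fun _ => 1 - X : SetFun ℕ ℤ[X]) * simplexFun = 1 := by
  have e : (1 - allOne + SetFun.mult fun _ => 1 - X : SetFun ℕ ℤ[X]) * simplexFun =
      simplexFun - simplexFun * (allOne - SetFun.mult fun _ => 1 - X) := by ring
  ext1 S
  have e2 : ∀ T ∈ S.powerset,
      simplexFun T * (allOne - SetFun.mult fun _ => 1 - X : SetFun ℕ ℤ[X]) (S \ T) =
      simplexPoly T.card * (1 - (1 - X) ^ (S.card - T.card)) := by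
    intro T hT
    rw [SetFun.sub_apply, allOne_apply, SetFun.mult_const_apply,
      Finset.card_sdiff_of_subset (Finset.mem_powerset.mp hT)]
    rfl
  rw [e, SetFun.sub_apply, SetFun.mul_apply, Finset.sum_congr rfl e2,
    Finset.sum_powerset_apply_card (fun l => simplexPoly l * (1 - (1 - X) ^ (S.card - l))),
    SetFun.one_apply]
  rcases S.eq_empty_or_nonempty with rfl | hS
  · simp [simplexFun, simplexPoly]
  · rw [if_neg hS.ne_empty, ← simplexPoly_eq hS.card_ne_zero]
    exact sub_self _

theorem transformPoly_eq (n k : ℕ) :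
    ((∑ r ∈ Finset.range (n + 1), bichromatic ^ r) * powXInter (Finset.Icc 1 k) :
      SetFun ℕ ℤ[X]) (Finset.Icc 1 n) = transformPoly n k := by
  set A := Finset.Icc 1 k
  set E : SetFun ℕ ℤ[X] := SetFun.mult fun i => if i ∈ A then 0 else 1 - X with hE
  set v : SetFun ℕ ℤ[X] := SetFun.mult fun _ => 1 - X with hv
  have h1 : powX * v = allOne := by
    rw [powX, hv, SetFun.mult_mul_mult, allOne]
    congr 1
    ext1 i
    simp
  have h2 : powX * E = powXInter A := by
    rw [powX, hE, SetFun.mult_mul_mult, powXInter]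
    congr 1
    ext1 i
    by_cases hi : i ∈ A <;> simp [hi]
  -- By `h1`, `1 - bichromatic = powX * (1 - allOne + v)`; `simplexFun` cancels the second factor
  -- and `h2` evaluates `powX * E`.
  have h3 : (1 - bichromatic) * (E * simplexFun) = powXInter A := by
    rw [bichromatic]
    linear_combination (powX * E) * mul_simplexFun - E * simplexFun * h1 + h2
  have h4 := mul_neg_geom_sum bichromatic (n + 1)
  have h5 : (∑ r ∈ Finset.range (n + 1), bichromatic ^ r) * powXInter A =
      E * simplexFun - bichromatic ^ (n + 1) * (E * simplexFun) := by
    linear_combination (E * simplexFun) * h4 -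
      (∑ r ∈ Finset.range (n + 1), bichromatic ^ r) * h3
  rw [h5, SetFun.sub_apply, SetFun.pow_mul_apply_eq_zero bichromatic_empty (by simp), sub_zero,
    SetFun.mul_apply, transformPoly]
  have h6 : Finset.Icc 1 n \ A = Finset.Icc (k + 1) n := by
    ext i
    simp only [A, Finset.mem_sdiff, Finset.mem_Icc]
    omega
  have h7 : (Finset.Icc (k + 1) n).card = n - k := by simp
  rw [← h7, ← Finset.sum_powerset_apply_card fun l => (1 - X) ^ l * simplexPoly (n - l)]
  symm
  -- `E` vanishes on sets meeting `[k]`, so only subsets of `[n] \ [k]` contribute to the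
  -- convolution; they are counted by cardinality.
  refine Finset.sum_subset_zero_on_sdiff ?_ ?_ ?_
  · exact Finset.powerset_mono.mpr (h6 ▸ Finset.sdiff_subset)
  · intro T hT
    rw [Finset.mem_sdiff, Finset.mem_powerset, Finset.mem_powerset, ← h6, Finset.subset_sdiff,
      not_and] at hT
    rw [hE, mult_zero_ite_apply, if_neg (hT.2 hT.1), zero_mul]
  · intro T hT
    rw [Finset.mem_powerset, ← h6, Finset.subset_sdiff] at hT
    rw [hE, mult_zero_ite_apply, if_pos hT.2, simplexFun, Finset.card_sdiff_of_subset hT.1]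
    simp

theorem coeff_transformPoly_eq_ncard_halfUnionPartitions (n k j : ℕ) :
    (transformPoly n k).coeff j = ((halfUnionPartitions n k j).ncard : ℤ) := by
  rw [ncard_halfUnionPartitions, transformPoly_eq]

theorem coeff_transformPoly_eq_ncard_coloredPartitions {n k : ℕ} (hk : k ≤ n) (j : ℕ) :
    (transformPoly n k).coeff j = ((coloredPartitions n k j).ncard : ℤ) := by
  rw [ncard_coloredPartitions hk, coloredGF_eq _ _ (by simp), transformPoly_eq]

end Transform

/-! ### Cliques of pointed faces -/

section Cliques

variable {V : Type*} [DecidableEq V]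

/-- A set of pairs `(F, v)` with `v ∈ F` any two of which are equal or adjacent in the graph of
pointed faces. -/
structure IsLayered (C : Finset (Finset V × V)) : Prop where
  mem : ∀ p ∈ C, p.2 ∈ p.1
  rel : ∀ p ∈ C, ∀ q ∈ C, p.1 = q.1 ∨ (p.1 ⊂ q.1 ∧ q.2 ∉ p.1) ∨ (q.1 ⊂ p.1 ∧ p.2 ∉ q.1)

omit [DecidableEq V] in
theorem IsLayered.mono {C D : Finset (Finset V × V)} (h : IsLayered C) (hD : D ⊆ C) :
    IsLayered D :=
  ⟨fun p hp => h.mem p (hD hp), fun p hp q hq => h.rel p (hD hp) q (hD hq)⟩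

/-- The faces occurring in a clique form a chain, so one of maximal cardinality contains all others.
-/
theorem IsLayered.exists_eq_sup {C : Finset (Finset V × V)} (h : IsLayered C)
    (hC : C.Nonempty) : ∃ p ∈ C, p.1 = C.sup Prod.fst := by
  obtain ⟨p, hp, hmax⟩ := C.exists_max_image (fun p => p.1.card) hC
  refine ⟨p, hp, le_antisymm (Finset.le_sup (f := Prod.fst) hp) (Finset.sup_le fun q hq => ?_)⟩
  rcases h.rel p hp q hq with h1 | ⟨h1, -⟩ | ⟨h1, -⟩
  · exact h1.ge
  · exact absurd (Finset.card_lt_card h1) (hmax q hq).not_gt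
  · exact h1.subset

/-- The points of a clique are distinct: between two different faces, the point of the larger one
avoids the smaller face, which contains its own point. -/
theorem IsLayered.card_le {C : Finset (Finset V × V)} (h : IsLayered C) :
    C.card ≤ (C.sup Prod.fst).card := by
  refine Finset.card_le_card_of_injOn Prod.snd (fun p hp => ?_) fun p hp q hq hpq => ?_
  · exact Finset.le_sup (f := Prod.fst) hp (h.mem p hp)
  · rcases h.rel p hp q hq with h1 | ⟨-, h1⟩ | ⟨-, h1⟩
    · exact Prod.ext h1 hpq
    · exact absurd (hpq ▸ h.mem p hp) h1
    · exact absurd (hpq ▸ h.mem q hq) h1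

open scoped Classical in
/-- The cliques of pointed faces with largest face `F`. -/
noncomputable def cliquesOn (F : Finset V) : Finset (Finset (Finset V × V)) :=
  (F.powerset ×ˢ F).powerset.filter fun C => IsLayered C ∧ C.sup Prod.fst = F

theorem mem_cliquesOn {F : Finset V} {C : Finset (Finset V × V)} :
    C ∈ cliquesOn F ↔ IsLayered C ∧ C.sup Prod.fst = F := by
  classical
  rw [cliquesOn, Finset.mem_filter, and_iff_right_iff_imp]
  rintro ⟨h, rfl⟩
  rw [Finset.mem_powerset]
  intro p hp
  have := Finset.le_sup (f := Prod.fst) hp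
  exact Finset.mem_product.mpr ⟨Finset.mem_powerset.mpr this, this (h.mem p hp)⟩

theorem cliquesOn_empty : cliquesOn (∅ : Finset V) = {∅} := by
  ext C
  rw [mem_cliquesOn, Finset.mem_singleton]
  constructor
  · rintro ⟨h, hC⟩
    have := h.card_le
    rw [hC, Finset.card_empty] at this
    exact Finset.card_eq_zero.mp (by omega)
  · rintro rfl
    exact ⟨⟨by simp, by simp⟩, by simp⟩

/-- Add to `C` the pointed faces with face `F` and point in `T`. -/
def addLayer (F : Finset V) (C : Finset (Finset V × V)) (T : Finset V) :
    Finset (Finset V × V) := C ∪ T.image fun v => (F, v)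

theorem mem_addLayer {F T : Finset V} {C : Finset (Finset V × V)} {p : Finset V × V} :
    p ∈ addLayer F C T ↔ p ∈ C ∨ (p.1 = F ∧ p.2 ∈ T) := by
  obtain ⟨G, v⟩ := p
  simp only [addLayer, Finset.mem_union, Finset.mem_image, Prod.mk.injEq]
  constructor
  · rintro (h | ⟨w, h, rfl, rfl⟩)
    exacts [Or.inl h, Or.inr ⟨rfl, h⟩]
  · rintro (h | ⟨rfl, h⟩)
    exacts [Or.inl h, Or.inr ⟨v, h, rfl, rfl⟩]

theorem fst_ssubset {F F' : Finset V} {C : Finset (Finset V × V)} (hF : F' ⊂ F)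
    (hC : C.sup Prod.fst = F') {p : Finset V × V} (hp : p ∈ C) : p.1 ⊂ F :=
  lt_of_le_of_lt (hC ▸ Finset.le_sup (f := Prod.fst) hp : p.1 ≤ F') hF

/-- Every face in `C` lies in `F'`, so points outside `F'` satisfy the adjacency condition against
all of `C`. -/
theorem addLayer_mem_cliquesOn {F F' T : Finset V} {C : Finset (Finset V × V)} (hF : F' ⊂ F)
    (hC : C ∈ cliquesOn F') (hT : T ⊆ F \ F') (hne : T.Nonempty) :
    addLayer F C T ∈ cliquesOn F := by
  rw [mem_cliquesOn] at hC ⊢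
  obtain ⟨h, hsup⟩ := hC
  have hle : ∀ p ∈ C, p.1 ⊆ F' := fun p hp => hsup ▸ Finset.le_sup (f := Prod.fst) hp
  refine ⟨⟨fun p hp => ?_, fun p hp q hq => ?_⟩, ?_⟩
  · rcases mem_addLayer.mp hp with hp | ⟨h1, h2⟩
    · exact h.mem p hp
    · exact h1 ▸ (Finset.mem_sdiff.mp (hT h2)).1
  · rcases mem_addLayer.mp hp with hp | ⟨h1, h2⟩ <;>
      rcases mem_addLayer.mp hq with hq | ⟨h3, h4⟩
    · exact h.rel p hp q hq
    · exact Or.inr (Or.inl ⟨h3 ▸ fst_ssubset hF hsup hp,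
        fun h5 => (Finset.mem_sdiff.mp (hT h4)).2 (hle p hp h5)⟩)
    · exact Or.inr (Or.inr ⟨h1 ▸ fst_ssubset hF hsup hq,
        fun h5 => (Finset.mem_sdiff.mp (hT h2)).2 (hle q hq h5)⟩)
    · exact Or.inl (h1.trans h3.symm)
  · refine le_antisymm (Finset.sup_le fun p hp => ?_) ?_
    · rcases mem_addLayer.mp hp with hp | ⟨h1, -⟩
      · exact (fst_ssubset hF hsup hp).subset
      · exact h1.le
    · obtain ⟨v, hv⟩ := hne
      exact Finset.le_sup (f := Prod.fst)
        (mem_addLayer.mpr (Or.inr ⟨rfl, hv⟩) : (F, v) ∈ addLayer F C T)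

theorem filter_addLayer {F F' T : Finset V} {C : Finset (Finset V × V)} (hF : F' ⊂ F)
    (hC : C.sup Prod.fst = F') : (addLayer F C T).filter (fun p => p.1 ≠ F) = C := by
  ext p
  rw [Finset.mem_filter, mem_addLayer]
  constructor
  · rintro ⟨h1 | h1, h2⟩
    exacts [h1, absurd h1.1 h2]
  · exact fun h => ⟨Or.inl h, (fst_ssubset hF hC h).ne⟩

theorem image_filter_addLayer {F F' T : Finset V} {C : Finset (Finset V × V)} (hF : F' ⊂ F)
    (hC : C.sup Prod.fst = F') :
    ((addLayer F C T).filter (fun p => p.1 = F)).image Prod.snd = T := by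
  ext v
  simp only [Finset.mem_image, Finset.mem_filter, mem_addLayer]
  constructor
  · rintro ⟨p, ⟨h1 | h1, h2⟩, rfl⟩
    exacts [absurd h2 (fst_ssubset hF hC h1).ne, h1.2]
  · exact fun h => ⟨(F, v), ⟨Or.inr ⟨rfl, h⟩, rfl⟩, rfl⟩

theorem addLayer_filter (F : Finset V) (C : Finset (Finset V × V)) :
    addLayer F (C.filter fun p => p.1 ≠ F) ((C.filter fun p => p.1 = F).image Prod.snd) = C := by
  ext ⟨G, v⟩
  simp only [mem_addLayer, Finset.mem_filter, Finset.mem_image]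
  constructor
  · rintro (h | ⟨rfl, ⟨G', v'⟩, ⟨h1, h2⟩, h3⟩)
    · exact h.1
    · cases h2; cases h3; exact h1
  · intro h
    by_cases hG : G = F
    · exact Or.inr ⟨hG, (G, v), ⟨h, hG⟩, rfl⟩
    · exact Or.inl ⟨h, hG⟩

theorem sup_filter_ssubset {F : Finset V} (hF : F.Nonempty) {C : Finset (Finset V × V)}
    (hC : C ∈ cliquesOn F) : (C.filter fun p => p.1 ≠ F).sup Prod.fst ⊂ F := by
  obtain ⟨h, hsup⟩ := mem_cliquesOn.mp hC
  refine Finset.ssubset_iff_subset_ne.mpr ⟨?_, ?_⟩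
  · exact (Finset.sup_mono (Finset.filter_subset _ _)).trans hsup.le
  · rcases (C.filter fun p => p.1 ≠ F).eq_empty_or_nonempty with h1 | h1
    · rw [h1]
      exact hF.ne_empty.symm
    · obtain ⟨p, hp, h2⟩ := (h.mono (Finset.filter_subset _ _)).exists_eq_sup h1
      exact h2 ▸ (Finset.mem_filter.mp hp).2

theorem image_filter_subset {F : Finset V} {C : Finset (Finset V × V)} (hC : C ∈ cliquesOn F) :
    (C.filter fun p => p.1 = F).image Prod.snd ⊆
      F \ (C.filter fun p => p.1 ≠ F).sup Prod.fst := by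
  obtain ⟨h, hsup⟩ := mem_cliquesOn.mp hC
  intro v hv
  obtain ⟨q, hq, rfl⟩ := Finset.mem_image.mp hv
  obtain ⟨hqC, rfl⟩ := Finset.mem_filter.mp hq
  refine Finset.mem_sdiff.mpr ⟨h.mem q hqC, fun hv => ?_⟩
  obtain ⟨p, hp, hv⟩ := Finset.mem_sup.mp hv
  obtain ⟨hp, hpq⟩ := Finset.mem_filter.mp hp
  rcases h.rel p hp q hqC with h1 | ⟨-, h1⟩ | ⟨h1, -⟩
  · exact hpq h1
  · exact h1 hv
  · exact h1.not_subset (hsup ▸ Finset.le_sup (f := Prod.fst) hp)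

theorem image_filter_nonempty {F : Finset V} (hF : F.Nonempty) {C : Finset (Finset V × V)}
    (hC : C ∈ cliquesOn F) : ((C.filter fun p => p.1 = F).image Prod.snd).Nonempty := by
  obtain ⟨h, hsup⟩ := mem_cliquesOn.mp hC
  have hne : C.Nonempty := by
    rw [Finset.nonempty_iff_ne_empty]
    rintro rfl
    exact hF.ne_empty hsup.symm
  obtain ⟨p, hp, hpF⟩ := h.exists_eq_sup hne
  exact ⟨p.2, Finset.mem_image_of_mem _ (Finset.mem_filter.mpr ⟨hp, hpF.trans hsup⟩)⟩

/-- A clique is determined by its top layer over `F` and the clique below it; adjacency forces the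
points of the top layer to avoid the largest lower face `F'`. This is the source of the recursion
for `simplexPoly`. -/
theorem sum_cliquesOn {M : Type*} [AddCommMonoid M] {F : Finset V} (hF : F.Nonempty)
    (g : Finset (Finset V × V) → M) :
    ∑ C ∈ cliquesOn F, g C = ∑ F' ∈ F.ssubsets, ∑ C ∈ cliquesOn F',
      ∑ T ∈ (F \ F').powerset with T.Nonempty, g (addLayer F C T) := by
  simp only [← Finset.sum_product']
  rw [Finset.sum_sigma']
  refine Finset.sum_bij'
    (fun C _ => ⟨(C.filter fun p => p.1 ≠ F).sup Prod.fst,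
      (C.filter fun p => p.1 ≠ F, (C.filter fun p => p.1 = F).image Prod.snd)⟩)
    (fun s _ => addLayer F s.2.1 s.2.2) ?_ ?_ ?_ ?_ ?_
  · intro C hC
    simp only [Finset.mem_sigma, Finset.mem_ssubsets, Finset.mem_product, Finset.mem_filter,
      Finset.mem_powerset]
    exact ⟨sup_filter_ssubset hF hC, mem_cliquesOn.mpr
      ⟨(mem_cliquesOn.mp hC).1.mono (Finset.filter_subset _ _), rfl⟩,
      image_filter_subset hC, image_filter_nonempty hF hC⟩
  · rintro ⟨F', C, T⟩ h
    simp only [Finset.mem_sigma, Finset.mem_ssubsets, Finset.mem_product, Finset.mem_filter,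
      Finset.mem_powerset] at h
    exact addLayer_mem_cliquesOn h.1 h.2.1 h.2.2.1 h.2.2.2
  · intro C _
    exact addLayer_filter F C
  · rintro ⟨F', C, T⟩ h
    simp only [Finset.mem_sigma, Finset.mem_ssubsets, Finset.mem_product, Finset.mem_filter,
      Finset.mem_powerset] at h
    have hC := (mem_cliquesOn.mp h.2.1).2
    simp only [filter_addLayer h.1 hC, image_filter_addLayer h.1 hC, hC]
  · intro C _
    simp only [addLayer_filter]

theorem card_addLayer {F F' T : Finset V} {C : Finset (Finset V × V)} (hF : F' ⊂ F)
    (hC : C ∈ cliquesOn F') : (addLayer F C T).card = C.card + T.card := by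
  rw [addLayer, Finset.card_union_of_disjoint, Finset.card_image_of_injective]
  · exact fun v w h => (Prod.mk.inj h).2
  · rw [Finset.disjoint_left]
    intro p hp hp'
    obtain ⟨v, -, rfl⟩ := Finset.mem_image.mp hp'
    exact (fst_ssubset hF (mem_cliquesOn.mp hC).2 hp).ne rfl

open Polynomial

/-- The binomial theorem for `X + (1 - X) = 1`, with the term of the empty set taken out. -/
theorem sum_powerset_nonempty (D : Finset V) :
    ∑ T ∈ D.powerset with T.Nonempty, (X ^ T.card * (1 - X) ^ (D.card - T.card) : ℤ[X]) =
      1 - (1 - X) ^ D.card := by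
  have h := Finset.sum_pow_mul_eq_add_pow (X : ℤ[X]) (1 - X) D
  rw [add_sub_cancel, one_pow, ← Finset.sum_filter_add_sum_filter_not _ Finset.Nonempty] at h
  have : D.powerset.filter (fun T => ¬ T.Nonempty) = {∅} := by
    ext T
    simp only [Finset.mem_filter, Finset.mem_powerset, Finset.not_nonempty_iff_eq_empty,
      Finset.mem_singleton, and_iff_right_iff_imp]
    rintro rfl
    exact Finset.empty_subset D
  rw [this] at h
  simp only [Finset.sum_singleton, Finset.card_empty, pow_zero, one_mul, Nat.sub_zero] at h
  exact eq_sub_of_add_eq h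

theorem sum_cliquesOn_eq_simplexPoly (F : Finset V) :
    ∑ C ∈ cliquesOn F, (X ^ C.card * (1 - X) ^ (F.card - C.card) : ℤ[X]) =
      simplexPoly F.card := by
  induction F using Finset.strongInduction with
  | H F ih =>
  rcases F.eq_empty_or_nonempty with rfl | hF
  · simp [cliquesOn_empty, simplexPoly]
  · rw [sum_cliquesOn hF, simplexPoly_eq hF.card_ne_zero,
      ← Finset.sum_powerset_apply_card fun l => simplexPoly l * (1 - (1 - X) ^ (F.card - l)),
      ← Finset.sum_subset (fun F' hF' => ?_ : F.ssubsets ⊆ F.powerset)]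
    · refine Finset.sum_congr rfl fun F' hF' => ?_
      rw [Finset.mem_ssubsets] at hF'
      rw [← Finset.card_sdiff_of_subset hF'.subset, ← sum_powerset_nonempty, ← ih F' hF',
        Finset.sum_mul_sum]
      refine Finset.sum_congr rfl fun C hC => Finset.sum_congr rfl fun T hT => ?_
      have h1 : C.card ≤ F'.card := by
        obtain ⟨h, h'⟩ := mem_cliquesOn.mp hC
        exact h' ▸ h.card_le
      have h2 : T.card ≤ (F \ F').card :=
        Finset.card_le_card (Finset.mem_powerset.mp (Finset.mem_filter.mp hT).1)
      have h3 := Finset.card_sdiff_add_card_eq_card hF'.subset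
      -- The truncated subtractions split thanks to `h1` and `h2`, which makes the weight
      -- multiplicative in `C` and `T`.
      rw [card_addLayer hF' hC, show F.card - (C.card + T.card) =
        (F'.card - C.card) + ((F \ F').card - T.card) by omega, pow_add, pow_add]
      ring
    · intro F' h1 h2
      have : F' = F := by
        by_contra hne
        exact h2 (Finset.mem_ssubsets.mpr
          (Finset.ssubset_iff_subset_ne.mpr ⟨Finset.mem_powerset.mp h1, hne⟩))
      simp [this]
    · exact Finset.mem_powerset.mpr (Finset.mem_ssubsets.mp hF').subset

end Cliques

/-! ### The `f`-vector and the `h`-vector of the antiprism triangulation -/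

section Vectors

open Polynomial

variable {V : Type u} [Finite V]

/-- The faces of `Δ`, the empty face included. -/
noncomputable def extFaces (Δ : AbstractSimplicialComplex V) : Finset (Finset V) :=
  (Set.toFinite {F : Finset V | F = ∅ ∨ F ∈ Δ.faces}).toFinset

theorem mem_extFaces {Δ : AbstractSimplicialComplex V} {F : Finset V} :
    F ∈ extFaces Δ ↔ F = ∅ ∨ F ∈ Δ.faces := by
  rw [extFaces, Set.Finite.mem_toFinset]
  rfl

theorem fNumber_eq_card (Δ : AbstractSimplicialComplex V) (j : ℕ) :
    fNumber Δ j = ((extFaces Δ).filter fun F => F.card = j).card := by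
  rw [fNumber, ← Set.ncard_coe_finset]
  congr 1
  ext F
  simp [mem_extFaces]

theorem bddAbove_card_faces (Δ : AbstractSimplicialComplex V) :
    BddAbove (Finset.card '' Δ.faces) :=
  (Set.toFinite _).bddAbove

theorem card_le_size {Δ : AbstractSimplicialComplex V} {F : Finset V} (hF : F ∈ extFaces Δ) :
    F.card ≤ size Δ := by
  rcases mem_extFaces.mp hF with rfl | hF
  · simp
  · exact le_csSup (bddAbove_card_faces Δ) (Set.mem_image_of_mem _ hF)

theorem exists_card_eq_size {Δ : AbstractSimplicialComplex V} (h : 1 ≤ size Δ) :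
    ∃ F ∈ Δ.faces, F.card = size Δ := by
  refine Nat.sSup_mem ?_ (bddAbove_card_faces Δ)
  by_contra hne
  rw [Set.not_nonempty_iff_eq_empty] at hne
  rw [size, hne, csSup_empty] at h
  exact absurd h (by simp)

theorem subset_mem_extFaces {Δ : AbstractSimplicialComplex V} {F G : Finset V}
    (hF : F ∈ extFaces Δ) (hG : G ⊆ F) : G ∈ extFaces Δ := by
  rw [mem_extFaces] at hF ⊢
  rcases G.eq_empty_or_nonempty with h | h
  · exact Or.inl h
  · rcases hF with rfl | hF
    · exact Or.inl (Finset.subset_empty.mp hG)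
    · exact Or.inr ((Δ.isRelLowerSet_faces hF).2 hG h)

theorem sum_extFaces {M : Type*} [AddCommMonoid M] {Δ : AbstractSimplicialComplex V} {n : ℕ}
    (hn : size Δ ≤ n) (g : ℕ → M) :
    ∑ F ∈ extFaces Δ, g F.card = ∑ m ∈ Finset.range (n + 1), fNumber Δ m • g m := by
  rw [← Finset.sum_fiberwise_of_maps_to (t := Finset.range (n + 1)) (g := Finset.card)]
  · refine Finset.sum_congr rfl fun m _ => ?_
    rw [fNumber_eq_card, Finset.sum_congr rfl fun F hF => by rw [(Finset.mem_filter.mp hF).2],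
      Finset.sum_const]
  · intro F hF
    exact Finset.mem_range.mpr (Nat.lt_succ_of_le ((card_le_size hF).trans hn))

/-- The generating polynomial of the `h`-vector. -/
noncomputable def hPoly (Δ : AbstractSimplicialComplex V) : ℤ[X] :=
  ∑ F ∈ extFaces Δ, X ^ F.card * (1 - X) ^ (size Δ - F.card)

theorem coeff_one_sub_X_pow (m l : ℕ) :
    ((1 - X : ℤ[X]) ^ m).coeff l = (-1) ^ l * (m.choose l : ℤ) := by
  have h : (1 - X : ℤ[X]) = (1 + X).comp (C (-1) * X) := by simp [sub_eq_add_neg]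
  rw [h, ← pow_comp, comp_C_mul_X_coeff, coeff_one_add_X_pow, mul_comm]

/-- Faces with more than `j` elements contribute multiples of `X ^ (j + 1)`, hence nothing to the
coefficient. -/
theorem coeff_hPoly (Δ : AbstractSimplicialComplex V) {j : ℕ} (hj : j ≤ size Δ) :
    (hPoly Δ).coeff j = hNumber Δ j := by
  rw [hPoly, sum_extFaces le_rfl fun m => (X ^ m * (1 - X) ^ (size Δ - m) : ℤ[X]),
    finsetSum_coeff, hNumber]
  symm
  refine Finset.sum_subset_zero_on_sdiff
    (Finset.range_subset_range.mpr (Nat.succ_le_succ hj)) ?_ ?_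
  · intro m hm
    have : ¬ m ≤ j := by
      have := (Finset.mem_sdiff.mp hm).2
      rw [Finset.mem_range] at this
      omega
    rw [coeff_smul, coeff_X_pow_mul', if_neg this, smul_zero]
  · intro m hm
    rw [coeff_smul, coeff_X_pow_mul', if_pos (Nat.lt_succ_iff.mp (Finset.mem_range.mp hm)),
      coeff_one_sub_X_pow, nsmul_eq_mul]
    exact mul_comm _ _

section

variable [DecidableEq V]

omit [Finite V] in
theorem clique_iff_isLayered_map (Δ : AbstractSimplicialComplex V) (C : Finset (PointedFace Δ)) :
    (C = ∅ ∨ C ∈ (antiprismTriangulation Δ).faces) ↔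
      IsLayered (C.map (Function.Embedding.subtype _)) := by
  have h1 : (C = ∅ ∨ C ∈ (antiprismTriangulation Δ).faces) ↔
      (pointedFaceGraph Δ).IsClique (C : Set (PointedFace Δ)) := by
    rcases C.eq_empty_or_nonempty with rfl | hC
    · simp
    · rw [or_iff_right hC.ne_empty]
      exact and_iff_right hC
  rw [h1]
  constructor
  · intro h
    refine ⟨fun p hp => ?_, fun p hp q hq => ?_⟩
    · obtain ⟨p, -, rfl⟩ := Finset.mem_map.mp hp
      exact p.2.2
    · obtain ⟨a, ha, rfl⟩ := Finset.mem_map.mp hp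
      obtain ⟨b, hb, rfl⟩ := Finset.mem_map.mp hq
      by_cases hab : a = b
      · exact Or.inl (by rw [hab])
      · exact (h ha hb hab).2
  · intro h p hp q hq hpq
    exact ⟨hpq, h.rel _ (Finset.mem_map_of_mem _ hp) _ (Finset.mem_map_of_mem _ hq)⟩

theorem sup_map_mem_extFaces (Δ : AbstractSimplicialComplex V) {C : Finset (PointedFace Δ)}
    (h : IsLayered (C.map (Function.Embedding.subtype _))) :
    (C.map (Function.Embedding.subtype _)).sup Prod.fst ∈ extFaces Δ := by
  rcases (C.map (Function.Embedding.subtype _)).eq_empty_or_nonempty with hC | hC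
  · rw [hC]
    exact mem_extFaces.mpr (Or.inl rfl)
  · obtain ⟨p, hp, hsup⟩ := h.exists_eq_sup hC
    obtain ⟨p, -, rfl⟩ := Finset.mem_map.mp hp
    rw [← hsup]
    exact mem_extFaces.mpr (Or.inr p.2.1)

theorem exists_map_eq (Δ : AbstractSimplicialComplex V) {F : Finset V} (hF : F ∈ extFaces Δ)
    {C : Finset (Finset V × V)} (hC : C ∈ cliquesOn F) :
    ∃ D : Finset (PointedFace Δ), D.map (Function.Embedding.subtype _) = C := by
  classical
  obtain ⟨h, hsup⟩ := mem_cliquesOn.mp hC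
  refine ⟨C.subtype _, Finset.subtype_map_of_mem fun p hp => ⟨?_, h.mem p hp⟩⟩
  have := subset_mem_extFaces hF (hsup ▸ Finset.le_sup (f := Prod.fst) hp : p.1 ⊆ F)
  exact (mem_extFaces.mp this).resolve_left (Finset.ne_empty_of_mem (h.mem p hp))

/-- Faces of the triangulation are sorted by their largest underlying face; `cliquesOn F` depends
only on `F`, since all subsets of a face are faces. -/
theorem map_extFaces_antiprismTriangulation (Δ : AbstractSimplicialComplex V) :
    (extFaces (antiprismTriangulation Δ)).map
        (Finset.mapEmbedding (Function.Embedding.subtype _)).toEmbedding =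
      (extFaces Δ).biUnion cliquesOn := by
  ext C
  simp only [Finset.mem_map, mem_extFaces (Δ := antiprismTriangulation Δ),
    clique_iff_isLayered_map, Finset.mem_biUnion]
  constructor
  · rintro ⟨D, hD, rfl⟩
    exact ⟨_, sup_map_mem_extFaces Δ hD, mem_cliquesOn.mpr ⟨hD, rfl⟩⟩
  · rintro ⟨F, hF, hC⟩
    obtain ⟨D, rfl⟩ := exists_map_eq Δ hF hC
    exact ⟨D, (mem_cliquesOn.mp hC).1, rfl⟩

theorem sum_extFaces_antiprismTriangulation {M : Type*} [AddCommMonoid M]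
    (Δ : AbstractSimplicialComplex V) (g : ℕ → M) :
    ∑ C ∈ extFaces (antiprismTriangulation Δ), g C.card =
      ∑ F ∈ extFaces Δ, ∑ C ∈ cliquesOn F, g C.card := by
  rw [← Finset.sum_biUnion, ← map_extFaces_antiprismTriangulation, Finset.sum_map]
  · simp
  · intro F _ F' _ hne
    rw [Function.onFun, Finset.disjoint_left]
    intro C h1 h2
    exact hne ((mem_cliquesOn.mp h1).2.symm.trans (mem_cliquesOn.mp h2).2)

theorem size_antiprismTriangulation {Δ : AbstractSimplicialComplex V} (h : 1 ≤ size Δ) :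
    size (antiprismTriangulation Δ) = size Δ := by
  obtain ⟨F, hF, hcard⟩ := exists_card_eq_size h
  have hF' : F ∈ extFaces Δ := mem_extFaces.mpr (Or.inr hF)
  -- All pointed faces over one face of maximal cardinality form a clique of that cardinality, which
  -- gives the lower bound; `IsLayered.card_le` gives the upper one.
  have hmem : F.image (fun v => (F, v)) ∈ cliquesOn F := by
    refine mem_cliquesOn.mpr ⟨⟨?_, ?_⟩, ?_⟩
    · simp
    · simp
    · have hne : F.Nonempty := Finset.card_pos.mp (by omega)
      rw [Finset.sup_image]
      exact Finset.sup_const hne F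
  obtain ⟨D, hD⟩ := exists_map_eq Δ hF' hmem
  have hDF : D.card = size Δ := by
    rw [← Finset.card_map (Function.Embedding.subtype _), hD, Finset.card_image_of_injective,
      hcard]
    exact fun v w h => (Prod.mk.inj h).2
  refine le_antisymm ?_ ?_
  · refine csSup_le' ?_
    rintro _ ⟨C, hC, rfl⟩
    have hC' := (clique_iff_isLayered_map Δ C).mp (Or.inr hC)
    have := hC'.card_le.trans (card_le_size (sup_map_mem_extFaces Δ hC'))
    rwa [Finset.card_map] at this
  · rw [← hDF]
    refine card_le_size (mem_extFaces.mpr ((clique_iff_isLayered_map Δ D).mpr ?_))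
    rw [hD]
    exact (mem_cliquesOn.mp hmem).1

theorem hPoly_antiprismTriangulation {Δ : AbstractSimplicialComplex V} {n : ℕ} (hn : 1 ≤ n)
    (h : size Δ = n) :
    hPoly (antiprismTriangulation Δ) =
      ∑ m ∈ Finset.range (n + 1), fNumber Δ m • ((1 - X) ^ (n - m) * simplexPoly m) := by
  rw [hPoly, size_antiprismTriangulation (h ▸ hn), sum_extFaces_antiprismTriangulation Δ
    fun l => (X ^ l * (1 - X) ^ (size Δ - l) : ℤ[X]), ← sum_extFaces h.le]
  refine Finset.sum_congr rfl fun F hF => ?_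
  rw [← sum_cliquesOn_eq_simplexPoly, Finset.mul_sum]
  refine Finset.sum_congr rfl fun C hC => ?_
  have h1 := card_le_size hF
  have h2 : C.card ≤ F.card := by
    obtain ⟨h3, h4⟩ := mem_cliquesOn.mp hC
    exact h4 ▸ h3.card_le
  rw [show size Δ - C.card = (n - F.card) + (F.card - C.card) by omega, pow_add]
  ring

end

end Vectors

/-! ### Existence and uniqueness of the transformation -/

section Inversion

open Polynomial

theorem sum_range_sum_range {M : Type*} [AddCommMonoid M] (n : ℕ) (f : ℕ → ℕ → M) :
    ∑ k ∈ Finset.range (n + 1), ∑ i ∈ Finset.range (k + 1), f k i =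
      ∑ i ∈ Finset.range (n + 1), ∑ k ∈ Finset.Ico i (n + 1), f k i := by
  refine Finset.sum_comm' fun k i => ?_
  simp only [Finset.mem_range, Finset.mem_Ico]
  omega

/-- Binomial inversion: after the identity `Nat.choose_mul`, the coefficient of `f i` contains the
alternating sum of a row of binomials, which is zero unless `i = m`. -/
theorem sum_choose_mul_alternating (n m : ℕ) (f : ℕ → ℤ) :
    ∑ k ∈ Finset.range (m + 1), ((n - k).choose (m - k) : ℤ) *
      ∑ i ∈ Finset.range (k + 1), (-1) ^ (k - i) * ((n - i).choose (k - i) : ℤ) * f i = f m := by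
  simp only [Finset.mul_sum]
  rw [sum_range_sum_range]
  have h : ∀ i ∈ Finset.range (m + 1), ∑ k ∈ Finset.Ico i (m + 1),
      ((n - k).choose (m - k) : ℤ) * ((-1) ^ (k - i) * ((n - i).choose (k - i) : ℤ) * f i) =
        if i = m then f m else 0 := by
    intro i hi
    have hi' : i ≤ m := Nat.lt_succ_iff.mp (Finset.mem_range.mp hi)
    rw [Finset.sum_Ico_eq_sum_range, show m + 1 - i = (m - i) + 1 by omega]
    have h1 : ∀ l ∈ Finset.range (m - i + 1), ((n - (i + l)).choose (m - (i + l)) : ℤ) *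
        ((-1) ^ (i + l - i) * ((n - i).choose (i + l - i) : ℤ) * f i) =
          ((n - i).choose (m - i) : ℤ) * f i * ((-1) ^ l * ((m - i).choose l : ℤ)) := by
      intro l hl
      have h2 := Nat.choose_mul (n := n - i) (k := m - i) (s := l)
        (Nat.lt_succ_iff.mp (Finset.mem_range.mp hl))
      rw [Nat.add_sub_cancel_left, ← Nat.sub_sub, ← Nat.sub_sub]
      have h3 : ((n - i).choose (m - i) : ℤ) * ((m - i).choose l : ℤ) =
        ((n - i).choose l : ℤ) * ((n - i - l).choose (m - i - l) : ℤ) := by exact_mod_cast h2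
      linear_combination (-((-1) ^ l * f i)) * h3
    rw [Finset.sum_congr rfl h1, ← Finset.mul_sum, Int.alternating_sum_range_choose]
    by_cases him : i = m
    · subst him; simp
    · rw [if_neg (by omega), if_neg him, mul_zero]
  rw [Finset.sum_congr rfl h]
  simp

variable {V : Type u}

theorem sum_choose_mul_hNumber (Δ : AbstractSimplicialComplex V) (m : ℕ) :
    ∑ k ∈ Finset.range (m + 1), ((size Δ - k).choose (m - k) : ℤ) * hNumber Δ k = fNumber Δ m :=
  sum_choose_mul_alternating (size Δ) m fun i => (fNumber Δ i : ℤ)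

theorem hPoly_antiprismTriangulation_eq_sum [Finite V] {Δ : AbstractSimplicialComplex V} {n : ℕ}
    (hn : 1 ≤ n) (h : size Δ = n) :
    hPoly (antiprismTriangulation Δ) =
      ∑ k ∈ Finset.range (n + 1), hNumber Δ k • transformPoly n k := by
  classical
  have h1 : ∀ m ∈ Finset.range (n + 1),
      fNumber Δ m • ((1 - X) ^ (n - m) * simplexPoly m) =
        ∑ k ∈ Finset.range (m + 1),
          (((n - k).choose (m - k) : ℤ) * hNumber Δ k) • ((1 - X) ^ (n - m) * simplexPoly m) := by
    intro m _
    rw [← Finset.sum_smul, ← h, sum_choose_mul_hNumber, natCast_zsmul]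
  rw [hPoly_antiprismTriangulation hn h, Finset.sum_congr rfl h1, sum_range_sum_range]
  refine Finset.sum_congr rfl fun k hk => ?_
  have hk' : k ≤ n := Nat.lt_succ_iff.mp (Finset.mem_range.mp hk)
  rw [transformPoly, Finset.smul_sum]
  -- The summation index of `transformPoly` is the codimension `l = n - m` of the faces.
  refine Finset.sum_nbij' (fun m => n - m) (fun l => n - l) ?_ ?_ ?_ ?_ ?_
  · intro m hm
    rw [Finset.mem_Ico] at hm
    rw [Finset.mem_range]
    omega
  · intro l hl
    rw [Finset.mem_range] at hl
    rw [Finset.mem_Ico]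
    omega
  · intro m hm
    rw [Finset.mem_Ico] at hm
    omega
  · intro l hl
    rw [Finset.mem_range] at hl
    omega
  · intro m hm
    rw [Finset.mem_Ico] at hm
    have h2 : (n - k).choose (n - m) = (n - k).choose (m - k) := by
      rw [← Nat.choose_symm (show m - k ≤ n - k by omega)]
      congr 1
      omega
    rw [h2, show n - (n - m) = m by omega, mul_comm, mul_smul, natCast_zsmul]

theorem transformsHVectors_transformPoly {n : ℕ} (hn : 1 ≤ n) :
    TransformsHVectors.{u} n fun k j => (transformPoly n k).coeff j := by
  intro V _ Δ hΔ j hj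
  classical
  rw [← coeff_hPoly _ (by rw [size_antiprismTriangulation (hΔ ▸ hn), hΔ]; exact hj),
    hPoly_antiprismTriangulation_eq_sum hn hΔ, finsetSum_coeff]
  refine Finset.sum_congr rfl fun k _ => ?_
  rw [coeff_smul, smul_eq_mul, mul_comm]

end Inversion

/-! ### Test complexes: disjoint unions of two simplices -/

section TwoSimplices

variable {V : Type u} [Fintype V] [DecidableEq V]

/-- The disjoint union of a simplex on `L` and a simplex on the complement of `L`. -/
def twoSimplices (L : Finset V) : AbstractSimplicialComplex V where
  faces := {F | F.Nonempty ∧ (F ⊆ L ∨ F ⊆ Lᶜ)}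
  isRelLowerSet_faces := fun _ hF =>
    ⟨hF.1, fun _ hGF hG => ⟨hG, hF.2.imp hGF.trans hGF.trans⟩⟩
  singleton_mem := fun v => ⟨Finset.singleton_nonempty v, by
    simp only [Finset.singleton_subset_iff, Finset.mem_compl]
    exact em _⟩

theorem size_twoSimplices {L : Finset V} (hL : L.Nonempty) (h : Lᶜ.card ≤ L.card) :
    size (twoSimplices L) = L.card := by
  refine le_antisymm ?_ (card_le_size (mem_extFaces.mpr (Or.inr ⟨hL, Or.inl subset_rfl⟩)))
  refine csSup_le' ?_
  rintro _ ⟨F, hF, rfl⟩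
  rcases hF.2 with h1 | h1
  · exact Finset.card_le_card h1
  · exact (Finset.card_le_card h1).trans h

/-- The two simplices share only the empty face, so nonempty faces are counted without overlap. -/
theorem fNumber_twoSimplices (L : Finset V) (m : ℕ) :
    fNumber (twoSimplices L) (m + 1) = L.card.choose (m + 1) + Lᶜ.card.choose (m + 1) := by
  rw [← Finset.card_powersetCard, ← Finset.card_powersetCard, ← Finset.card_union_of_disjoint,
    ← Set.ncard_coe_finset, fNumber]
  · congr 1
    ext F
    simp only [Set.mem_ofPred_eq, Finset.mem_coe, Finset.mem_union, Finset.mem_powersetCard,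
      twoSimplices]
    constructor
    · rintro ⟨rfl | h1, h2⟩
      · simp at h2
      · exact h1.2.imp (⟨·, h2⟩) (⟨·, h2⟩)
    · have hne : F.card = m + 1 → F.Nonempty := fun h => Finset.card_pos.mp (by omega)
      rintro (⟨h1, h2⟩ | ⟨h1, h2⟩)
      · exact ⟨Or.inr ⟨hne h2, Or.inl h1⟩, h2⟩
      · exact ⟨Or.inr ⟨hne h2, Or.inr h1⟩, h2⟩
  · rw [Finset.disjoint_left]
    intro F h1 h2
    rw [Finset.mem_powersetCard] at h1 h2
    obtain ⟨v, hv⟩ : F.Nonempty := Finset.card_pos.mp (by omega)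
    exact Finset.mem_compl.mp (h2.1 hv) (h1.1 hv)

end TwoSimplices

/-! ### Linear independence of the entries of the `h`-vector -/

section Uniqueness

theorem fNumber_zero {V : Type u} (Δ : AbstractSimplicialComplex V) : fNumber Δ 0 = 1 := by
  rw [fNumber, Set.ncard_eq_one]
  refine ⟨∅, ?_⟩
  ext F
  simp only [Finset.card_eq_zero, Set.mem_ofPred_eq, Set.mem_singleton_iff]
  tauto

theorem exists_size_eq_fNumber_eq {n i : ℕ} (hn : 1 ≤ n) (hi : i ≤ n) :
    ∃ (V : Type u) (_ : Finite V) (Δ : AbstractSimplicialComplex V), size Δ = n ∧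
      ∀ m, fNumber Δ (m + 1) = n.choose (m + 1) + i.choose (m + 1) := by
  classical
  have hc : Fintype.card (ULift.{u} (Fin (n + i))) = n + i := by simp
  obtain ⟨L, -, hL⟩ := Finset.exists_subset_card_eq
    (s := (Finset.univ : Finset (ULift.{u} (Fin (n + i))))) (n := n)
    (by rw [Finset.card_univ, hc]; omega)
  have hL' : Lᶜ.card = i := by rw [Finset.card_compl, hL, hc]; omega
  refine ⟨ULift.{u} (Fin (n + i)), inferInstance, twoSimplices L, ?_, fun m => ?_⟩
  · rw [size_twoSimplices (Finset.card_pos.mp (by omega)) (by omega), hL]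
  · rw [fNumber_twoSimplices, hL, hL']

/-- The system is triangular: at `i = m + 1` the later binomials vanish and the one for `m` is `1`.
-/
theorem eq_zero_of_sum_mul_choose {n : ℕ} {c : ℕ → ℤ}
    (h : ∀ i ≤ n, ∑ m ∈ Finset.range n, c m * (i.choose (m + 1) : ℤ) = 0) :
    ∀ m < n, c m = 0 := by
  intro m
  induction m using Nat.strong_induction_on with
  | _ m ih =>
  intro hm
  have h1 := h (m + 1) hm
  rw [Finset.sum_eq_single m] at h1
  · simpa using h1
  · intro l hl hne
    rcases lt_or_gt_of_ne hne with h2 | h2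
    · rw [ih l h2 (Finset.mem_range.mp hl), zero_mul]
    · rw [Nat.choose_eq_zero_of_lt (by omega), Nat.cast_zero, mul_zero]
  · exact fun h2 => absurd (Finset.mem_range.mpr hm) h2

/-- The relation is tested on a simplex with `n` vertices together with a disjoint one with `i ≤ n`
vertices. Subtracting the case `i = 0` removes the contribution of the large simplex and `c 0`,
leaving a triangular system in `c (m + 1)`; then `c 0` vanishes too. -/
theorem eq_zero_of_sum_mul_fNumber {n : ℕ} (hn : 1 ≤ n) {c : ℕ → ℤ}
    (h : ∀ (V : Type u) [Finite V] (Δ : AbstractSimplicialComplex V), size Δ = n →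
      ∑ m ∈ Finset.range (n + 1), c m * (fNumber Δ m : ℤ) = 0) :
    ∀ m ≤ n, c m = 0 := by
  have h1 : ∀ i ≤ n, ∑ m ∈ Finset.range n, c (m + 1) * (n.choose (m + 1) : ℤ) +
      ∑ m ∈ Finset.range n, c (m + 1) * (i.choose (m + 1) : ℤ) + c 0 = 0 := by
    intro i hi
    obtain ⟨V, _, Δ, hΔ, hf⟩ := exists_size_eq_fNumber_eq.{u} hn hi
    have h2 := h V Δ hΔ
    rw [Finset.sum_range_succ', fNumber_zero] at h2
    simp only [hf] at h2
    rw [← Finset.sum_add_distrib]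
    push_cast at h2
    simpa only [mul_add, mul_one] using h2
  have h0 := h1 0 (Nat.zero_le n)
  simp only [Nat.choose_zero_succ, Nat.cast_zero, mul_zero, Finset.sum_const_zero, add_zero] at h0
  have h2 : ∀ m < n, c (m + 1) = 0 :=
    eq_zero_of_sum_mul_choose fun i hi => by linear_combination h1 i hi - h0
  intro m hm
  cases m with
  | zero =>
    rw [Finset.sum_eq_zero fun m hm => by rw [h2 m (Finset.mem_range.mp hm), zero_mul]] at h0
    simpa using h0
  | succ m => exact h2 m hm

theorem eq_zero_of_sum_mul_hNumber {n : ℕ} (hn : 1 ≤ n) {d : ℕ → ℤ}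
    (h : ∀ (V : Type u) [Finite V] (Δ : AbstractSimplicialComplex V), size Δ = n →
      ∑ k ∈ Finset.range (n + 1), d k * hNumber Δ k = 0) :
    ∀ k ≤ n, d k = 0 := by
  -- The sum is the coefficient of `fNumber Δ i` once the `h`-numbers are expanded.
  have h1 : ∀ i ≤ n,
      ∑ k ∈ Finset.Ico i (n + 1), d k * ((-1) ^ (k - i) * ((n - i).choose (k - i) : ℤ)) = 0 := by
    refine eq_zero_of_sum_mul_fNumber.{u} hn fun V _ Δ hΔ => ?_
    rw [← h V Δ hΔ]
    simp only [hNumber, hΔ, Finset.mul_sum, Finset.sum_mul]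
    rw [sum_range_sum_range]
    simp only [mul_assoc]
  intro k hk
  -- The system is unitriangular, with each equation involving only indices `≥ i`, so it is solved
  -- downward from `k = n`.
  induction hl : n - k using Nat.strong_induction_on generalizing k with
  | _ l ih =>
  have h2 := h1 k hk
  rw [Finset.sum_eq_sum_Ico_succ_bot (by omega), Finset.sum_eq_zero fun i hi => ?_] at h2
  · simpa using h2
  · rw [Finset.mem_Ico] at hi
    rw [ih (n - i) (by omega) i (by omega) rfl, zero_mul]

end Uniqueness

end Antiprism

theorem mainTheorem10 (n : ℕ) (hn : 1 ≤ n) :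
    (∃ p : ℕ → ℕ → ℤ, Antiprism.TransformsHVectors.{u} n p) ∧
    ∀ p : ℕ → ℕ → ℤ, Antiprism.TransformsHVectors.{u} n p →
      ∀ k ≤ n, ∀ j ≤ n,
        p k j = ((Antiprism.coloredPartitions n k j).ncard : ℤ) ∧
        p k j = ((Antiprism.halfUnionPartitions n k j).ncard : ℤ) := by
  have hT := Antiprism.transformsHVectors_transformPoly.{u} hn
  refine ⟨⟨_, hT⟩, fun p hp k hk j hj => ?_⟩
  -- For fixed `j`, the difference of two transformations is a linear relation among the
  -- `h`-numbers.
  have h : p k j - (Antiprism.transformPoly n k).coeff j = 0 := by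
    refine Antiprism.eq_zero_of_sum_mul_hNumber.{u} hn
      (d := fun k => p k j - (Antiprism.transformPoly n k).coeff j) (fun V _ Δ hΔ => ?_) k hk
    simp only [sub_mul, Finset.sum_sub_distrib]
    rw [← hp V Δ hΔ j hj, hT V Δ hΔ j hj, sub_self]
  rw [sub_eq_zero.mp h]
  exact ⟨Antiprism.coeff_transformPoly_eq_ncard_coloredPartitions hk j,
    Antiprism.coeff_transformPoly_eq_ncard_halfUnionPartitions n k j⟩
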